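/- Let $F$ be a non-Archimedean local field of residual characteristic $p$, unramified over $\mathbb{Q}_p$, with ring of integers $\mathcal{O}$, uniformizer $\varpi$, residue field of cardinality $q$ and normalized absolute value $|\cdot|$. Let $\psi:F\to\mathbb{C}^\times$ be a continuous additive character with conductor $\mathcal{O}$. For $1\le i\le 3$ let $d_i$ be a positive even integer, $V_i=F^{d_i}$, $J_i\in\mathrm{GL}_{d_i}(F)$ symmetric, $\mathcal{Q}_i(x)=\tfrac12{}^txJ_ix$; put $V=V_1\oplus V_2\oplus V_3$, $V(\mathcal O)=\prod_i\mathcal O^{d_i}$, $\mathcal{Q}(v)=\sum_i\mathcal{Q}_i(v_i)$, $\chi_{\mathcal Q}(a)=\prod_i(a_i,(-1)^{d_i/2}\det J_i)$ (Hilbert symbols), and let $Y^{\mathrm{sm}}(F)$ be the set of $v\in V(F)$ with $\mathcal{Q}_1(v_1)=\mathcal{Q}_2(v_2)=\mathcal{Q}_3(v_3)$ and at least two $v_i$ nonzero. Let $\rho=\rho_\psi$ be the Weil representation of $G(F)=\mathrm{SL}_2(F)^3$ on $\mathcal{S}(V(F))$. Assume that $\chi_{\mathcal Q}$ is trivial on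 $(\mathcal{O}^\times)^3$ and that $\rho(k)\mathbb{1}_{V(\mathcal{O})}=\mathbb{1}_{V(\mathcal{O})}$ for all $k\in\mathrm{SL}_2(\mathcal{O})^3$. Let $\mathrm{Sp}_6$ be the symplectic group of the form $\sum_{i=1}^3(x_iy_{i+3}-y_ix_{i+3})$, $[P,P]$ the derived group of its Siegel parabolic $P$ (the group of all $\left(\begin{smallmatrix}A&\\&{}^tA^{-1}\end{smallmatrix}\right)\left(\begin{smallmatrix}I_3&Z\\&I_3\end{smallmatrix}\right)$ with $\det A=1$, ${}^tZ=Z$), $c(\varpi)=\mathrm{diag}(\varpi^{-c},1,1,\varpi^{c},1,1)$ for $c\in\mathbb{Z}$, and let $$b=\sum_{j,k\ge0}q^{2j}\,\mathbb{1}_{[P,P](F)\,(k+2j)(\varpi)\,\mathrm{Sp}_6(\mathcal{O})}$$ be the basic function on $[P,P](F)\backslash\mathrm{Sp}_6(F)$. Embed $G$ in $\mathrm{Sp}_6$ by $\left(\begin{smallmatrix}a_i&b_i\\c_i&d_i\end{smallmatrix}\right)_i\mapsto\left(\begin{smallmatrix}\mathrm{diag}(a_i)&\mathrm{diag}(b_i)\\\mathrm{diag}(c_i)&\mathrm{diag}(d_i)\end{smallmatrix}\right)$,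 let $$\gamma_0=\left(\begin{smallmatrix}0&0&0&-1&0&0\\0&1&0&0&0&0\\0&0&1&0&0&0\\1&1&1&0&0&0\\0&0&0&-1&1&0\\0&0&0&-1&0&1\end{smallmatrix}\right),$$ let $N_0(F)\le G(F)$ be the group of all $\left(\left(\begin{smallmatrix}1&t_i\\&1\end{smallmatrix}\right)\right)_i$ with $t_1+t_2+t_3=0$, and for $v\in Y^{\mathrm{sm}}(F)$ let $$I(b,\mathbb{1}_{V(\mathcal{O})})(v)=\int_{N_0(F)\backslash G(F)}b(\gamma_0g)\,\rho(g)\mathbb{1}_{V(\mathcal{O})}(v)\,dg,$$ where the measure is the quotient of the Haar measures giving $\mathrm{SL}_2(\mathcal O)^3$ and $N_0(\mathcal{O})=N_0(F)\cap\mathrm{SL}_2(\mathcal O)^3$ measure one. Let $d^\times a$ be the Haar measure on $(F^\times)^3$ giving $(\mathcal{O}^\times)^3$ measure one. **Proposition.** Let $v\in Y^{\mathrm{sm}}(F)$. The integral $I(b,\mathbb{1}_{V(\mathcal{O})})(v)$ converges absolutely, and if $p\neq3$ it is equal to $$\sum_{j=0}^\infty\int\mathbb{1}_{\mathcal{O}}\!\left(\frac{\mathcal{Q}(v)}{\varpi^{4j}a_1a_2a_3}\right)\mathbb{1}_{V(\mathcal{O})}\!\left(\frac{v}{\varpi^{2j}a}\right)\bar\chi_{\mathcal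 Q}(\varpi^{2j}a)\prod_{i=1}^3\left(\frac{|a_i|}{q^{2j}}\right)^{1-d_i/2}d^\times a,$$ where $\frac{v}{\varpi^{2j}a}$ has components $\frac{v_i}{\varpi^{2j}a_i}$ and the integral is over the set of $a\in(\mathcal{O}\cap F^\times)^3$ with $$\max\left(|a_1^{-1}a_2a_3|,|a_2^{-1}a_1a_3|,|a_3^{-1}a_1a_2|\right)\le1;$$ the integrals and the sum converge absolutely. For every $p$, including $p=3$, the same holds with $\mathcal{Q}(v)$ replaced by $\mathcal{Q}(v)/3$, the common value of the $\mathcal{Q}_i(v_i)$. In particular, for every $p$, $I(b,\mathbb{1}_{V(\mathcal{O})})$ is supported in $V(\mathcal{O})$. -/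

import Mathlib

open MeasureTheory Matrix Filter Topology
open scoped NormedField Valued

noncomputable section

namespace UnramifiedTriple

/-! ### The local field -/

/-- `F` is a non-Archimedean local field that is unramified over `ℚ_p` (the prime `p` generates the
maximal ideal of the ring of integers), and its norm is the normalized absolute value
(`|p| = q⁻¹` for the uniformizer `p`, where `q` is the cardinality of the residue field). -/
class IsUnramifiedLocalField (p : ℕ) (F : Type*) [NontriviallyNormedField F]
    [IsUltrametricDist F] : Prop where
  prime : p.Prime
  charZero : CharZero F
  proper : ProperSpace F
  maximalIdeal_eq : 𝓂[F] = Ideal.span {(p : 𝒪[F])}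
  norm_p : ‖(p : F)‖ = (Nat.card 𝓀[F] : ℝ)⁻¹

/-- A continuous additive character whose conductor is the ring of integers. -/
structure IsUnramifiedChar {F : Type*} [NontriviallyNormedField F] [IsUltrametricDist F]
    (ψ : AddChar F Circle) : Prop where
  continuous : Continuous ψ
  conductor : ∀ x : F, (∀ y ∈ 𝒪[F], ψ (x * y) = 1) ↔ x ∈ 𝒪[F]

/-! ### Quadratic forms and the space `V = V₁ ⊕ V₂ ⊕ V₃` -/

section Quadratic

variable {F : Type*} [Field F]

/-- The inner product `⟨x, y⟩ = ᵗx J y`. -/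
def innerJ {n : ℕ} (J : Matrix (Fin n) (Fin n) F) (x y : Fin n → F) : F := x ⬝ᵥ J *ᵥ y

/-- The quadratic form `½ ᵗx J x`. -/
def quadForm {n : ℕ} (J : Matrix (Fin n) (Fin n) F) (x : Fin n → F) : F := innerJ J x x / 2

variable (F) in
/-- The `F`-points of `V = V₁ ⊕ V₂ ⊕ V₃`, with `V_i` of dimension `d i`. -/
abbrev V (d : Fin 3 → ℕ) : Type _ := (i : Fin 3) → Fin (d i) → F

/-- `𝒬(v) = 𝒬₁(v₁) + 𝒬₂(v₂) + 𝒬₃(v₃)`. -/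
def totalQuad {d : Fin 3 → ℕ} (J : (i : Fin 3) → Matrix (Fin (d i)) (Fin (d i)) F) (v : V F d) : F :=
  ∑ i, quadForm (J i) (v i)

/-- The `F`-points of the smooth locus of `Y = {𝒬₁(y₁) = 𝒬₂(y₂) = 𝒬₃(y₃)}`: at least two of the
three components are nonzero. -/
def Ysm {d : Fin 3 → ℕ} (J : (i : Fin 3) → Matrix (Fin (d i)) (Fin (d i)) F) : Set (V F d) :=
  {v | (∀ i j, quadForm (J i) (v i) = quadForm (J j) (v j)) ∧
    ∃ i j, i ≠ j ∧ v i ≠ 0 ∧ v j ≠ 0}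

open Classical in
/-- The Hilbert symbol: `(a, b) = 1` if `z² = a x² + b y²` has a nontrivial solution, and `-1`
otherwise. -/
def hilbertSym (a b : F) : ℤ :=
  if ∃ x y z : F, ¬(x = 0 ∧ y = 0 ∧ z = 0) ∧ z ^ 2 = a * x ^ 2 + b * y ^ 2 then 1 else -1

/-- The character `a ↦ (a, (-1)^{n/2} det J)` attached to a quadratic form of even dimension. -/
def chi {n : ℕ} (J : Matrix (Fin n) (Fin n) F) (a : F) : ℤ := hilbertSym a ((-1) ^ (n / 2) * J.det)

/-- `χ_𝒬(a) = χ_{𝒬₁}(a₁) χ_{𝒬₂}(a₂) χ_{𝒬₃}(a₃)`. -/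
def chiQ {d : Fin 3 → ℕ} (J : (i : Fin 3) → Matrix (Fin (d i)) (Fin (d i)) F) (a : Fin 3 → F) : ℂ :=
  ∏ i, (chi (J i) (a i) : ℂ)

end Quadratic

/-- The `𝒪`-points of `V`. -/
def VO (F : Type*) [NontriviallyNormedField F] [IsUltrametricDist F] (d : Fin 3 → ℕ) :
    Set (V F d) :=
  {v | ∀ i k, v i k ∈ 𝒪[F]}

/-- The group `G(F) = SL₂(F)³`. -/
abbrev G (F : Type*) [Field F] : Type _ := Fin 3 → SpecialLinearGroup (Fin 2) F

/-! ### The Weil representation -/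

section Weil

variable {F : Type*} [NontriviallyNormedField F] [MeasurableSpace F] {n : ℕ}

/-- `dt` is the self-dual Haar measure for the pairing `(v, t) ↦ ψ(ᵗv J t)`: Fourier inversion
`f^^(v) = f(-v)` holds for all locally constant compactly supported functions. -/
structure IsSelfDual (ψ : AddChar F Circle) (J : Matrix (Fin n) (Fin n) F)
    (dt : Measure (Fin n → F)) : Prop where
  haar : dt.IsAddHaarMeasure
  inversion : ∀ f : (Fin n → F) → ℂ, IsLocallyConstant f → HasCompactSupport f → ∀ v,
    ∫ s, (∫ t, f t * (ψ (innerJ J s t) : ℂ) ∂dt) * (ψ (innerJ J v s) : ℂ) ∂dt = f (-v)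

/-- The Weil index `γ(𝒬)` of the character of second degree `x ↦ ψ(𝒬(x))`: the (stable) value of
the Gaussian integrals `∫ ψ(𝒬(x)) dx` over growing balls, for the self-dual measure `dx`. -/
def weilIndex (ψ : AddChar F Circle) (J : Matrix (Fin n) (Fin n) F)
    (dt : Measure (Fin n → F)) : ℂ :=
  limUnder atTop fun R : ℝ => ∫ x in Metric.closedBall (0 : Fin n → F) R, (ψ (quadForm J x) : ℂ) ∂dt

/-- The action of `(1 t; 0 1)`. -/
def weilN (ψ : AddChar F Circle) (J : Matrix (Fin n) (Fin n) F) (t : F)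
    (f : (Fin n → F) → ℂ) (v : Fin n → F) : ℂ :=
  (ψ (t * quadForm J v) : ℂ) * f v

/-- The action of `(a 0; 0 a⁻¹)`. -/
def weilM (J : Matrix (Fin n) (Fin n) F) (a : F) (f : (Fin n → F) → ℂ) (v : Fin n → F) : ℂ :=
  (chi J a : ℂ) * ((‖a‖ ^ ((n : ℝ) / 2) : ℝ) : ℂ) * f (a • v)

/-- The action of `(0 1; -1 0)`. -/
def weilW (ψ : AddChar F Circle) (J : Matrix (Fin n) (Fin n) F) (dt : Measure (Fin n → F))
    (f : (Fin n → F) → ℂ) (v : Fin n → F) : ℂ :=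
  weilIndex ψ J dt * ∫ t, f t * (ψ (innerJ J v t) : ℂ) ∂dt

/-- The Weil representation of `SL₂(F)` on functions on `V_i(F)`, through the Bruhat decomposition:
for `g = (a b; c d)`,
`g = (1 ab; 0 1) (a 0; 0 a⁻¹)` if `c = 0`, and
`g = (1 a/c; 0 1) (-c⁻¹ 0; 0 -c) (0 1; -1 0) (1 d/c; 0 1)` if `c ≠ 0`. -/
def weilSL (ψ : AddChar F Circle) (J : Matrix (Fin n) (Fin n) F) (dt : Measure (Fin n → F))
    (g : SpecialLinearGroup (Fin 2) F) (f : (Fin n → F) → ℂ) : (Fin n → F) → ℂ :=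
  open Classical in
  if g 1 0 = 0 then weilN ψ J (g 0 0 * g 0 1) (weilM J (g 0 0) f)
  else weilN ψ J (g 0 0 / g 1 0)
    (weilM J (-(g 1 0)⁻¹) (weilW ψ J dt (weilN ψ J (g 1 1 / g 1 0) f)))

variable {d : Fin 3 → ℕ}

/-- The operator `weilSL` in the `i`-th variable of a function on `V(F)`. -/
def weilAt (ψ : AddChar F Circle) (J : (i : Fin 3) → Matrix (Fin (d i)) (Fin (d i)) F)
    (dt : (i : Fin 3) → Measure (Fin (d i) → F)) (i : Fin 3) (g : SpecialLinearGroup (Fin 2) F)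
    (f : V F d → ℂ) (v : V F d) : ℂ :=
  weilSL ψ (J i) (dt i) g (fun t => f (Function.update v i t)) (v i)

/-- The Weil representation `ρ` of `SL₂(F)³` on functions on `V(F)`. -/
def weilRep (ψ : AddChar F Circle) (J : (i : Fin 3) → Matrix (Fin (d i)) (Fin (d i)) F)
    (dt : (i : Fin 3) → Measure (Fin (d i) → F)) (g : G F) (f : V F d → ℂ) : V F d → ℂ :=
  weilAt ψ J dt 0 (g 0) (weilAt ψ J dt 1 (g 1) (weilAt ψ J dt 2 (g 2) f))

end Weil

/-! ### `Sp₆`, the embedding of `SL₂³`, and the basic function -/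

section Symplectic

variable {F : Type*} [Field F]

/-- The embedding `SL₂³ → Sp₆`. -/
def embedG (g : G F) : symplecticGroup (Fin 3) F :=
  ⟨fromBlocks (diagonal fun i => g i 0 0) (diagonal fun i => g i 0 1)
      (diagonal fun i => g i 1 0) (diagonal fun i => g i 1 1), by
    have h : ∀ i, g i 0 0 * g i 1 1 - g i 0 1 * g i 1 0 = 1 := fun i => by
      rw [← det_fin_two]; exact (g i).2
    rw [SymplecticGroup.mem_iff, Matrix.J, fromBlocks_transpose, fromBlocks_multiply,
      fromBlocks_multiply]
    simp only [diagonal_transpose, Matrix.mul_zero, Matrix.mul_one, zero_add, add_zero,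
      Matrix.mul_neg, Matrix.neg_mul, diagonal_mul_diagonal]
    congr 1
    · ext i j; by_cases hij : i = j <;> simp [hij]; ring
    · ext i j; by_cases hij : i = j
      · subst hij; simp; linear_combination -h i
      · simp [hij]
    · ext i j; by_cases hij : i = j
      · subst hij; simp; linear_combination h i
      · simp [hij]
    · ext i j; by_cases hij : i = j <;> simp [hij]; ring⟩

variable (F) in
/-- The representative `γ₀` of the open orbit. -/
def gamma0 : symplecticGroup (Fin 3) F :=
  ⟨fromBlocks !![0, 0, 0; 0, 1, 0; 0, 0, 1] !![-1, 0, 0; 0, 0, 0; 0, 0, 0]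
      !![1, 1, 1; 0, 0, 0; 0, 0, 0] !![0, 0, 0; -1, 1, 0; -1, 0, 1], by
    rw [SymplecticGroup.mem_iff, Matrix.J, fromBlocks_transpose, fromBlocks_multiply,
      fromBlocks_multiply]
    congr 1 <;> ext i j <;> simp only [Matrix.add_apply, Matrix.mul_apply, Fin.sum_univ_three] <;>
      fin_cases i <;> fin_cases j <;> simp⟩

variable (F) in
/-- `[P, P](F)`: the products `(A 0; 0 ᵗA⁻¹) (1 Z; 0 1)` with `A ∈ SL₃(F)` and `Z` symmetric. -/
def siegelDerived : Set (Matrix (Fin 3 ⊕ Fin 3) (Fin 3 ⊕ Fin 3) F) :=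
  {h | ∃ A Z : Matrix (Fin 3) (Fin 3) F, A.det = 1 ∧ Zᵀ = Z ∧
    h = fromBlocks A 0 0 (A⁻¹)ᵀ * fromBlocks 1 Z 0 1}

/-- The cocharacter value `c(x) = diag(x^{-c}, 1, 1, x^c, 1, 1)`. -/
def cochar (c : ℤ) (x : F) : Matrix (Fin 3 ⊕ Fin 3) (Fin 3 ⊕ Fin 3) F :=
  fromBlocks (diagonal ![x ^ (-c), 1, 1]) 0 0 (diagonal ![x ^ c, 1, 1])

variable (F) in
/-- The unipotent subgroup `N₀(F)` of `SL₂(F)³`. -/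
def N0 : Subgroup (G F) where
  carrier := {g | ∃ t : Fin 3 → F, ∑ i, t i = 0 ∧
    ∀ i, (g i : Matrix (Fin 2) (Fin 2) F) = !![1, t i; 0, 1]}
  mul_mem' := by
    rintro a b ⟨s, hs, ha⟩ ⟨t, ht, hb⟩
    refine ⟨s + t, by simp [Finset.sum_add_distrib, hs, ht], fun i => ?_⟩
    simp [ha i, hb i, add_comm]
  one_mem' := ⟨0, by simp, fun i => by simp [Matrix.one_fin_two]⟩
  inv_mem' := by
    rintro a ⟨s, hs, ha⟩
    refine ⟨-s, by simp [hs], fun i => ?_⟩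
    simp [ha i, Matrix.adjugate_fin_two]

variable (F) in
/-- The space of right cosets `N₀(F) \ G(F)`. -/
abbrev N0Quot : Type _ := Quotient (QuotientGroup.rightRel (N0 F))

end Symplectic

section Basic

variable {F : Type*} [NontriviallyNormedField F] [IsUltrametricDist F]

variable (F) in
/-- `SL₂(𝒪)³`. -/
def GO : Set (G F) := {g | ∀ i r s, g i r s ∈ 𝒪[F]}

variable (F) in
/-- `Sp₆(𝒪)`, as a subset of `Sp₆(F)`. -/
def SpO : Set (symplecticGroup (Fin 3) F) :=
  {k | ∀ r s, (k : Matrix (Fin 3 ⊕ Fin 3) (Fin 3 ⊕ Fin 3) F) r s ∈ 𝒪[F]}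

/-- The double coset `[P, P](F) c(ϖ) Sp₆(𝒪)` in `Sp₆(F)`. -/
def doubleCoset (ϖ : F) (c : ℤ) : Set (symplecticGroup (Fin 3) F) :=
  {g | ∃ h ∈ siegelDerived F, ∃ k ∈ SpO F,
    (g : Matrix (Fin 3 ⊕ Fin 3) (Fin 3 ⊕ Fin 3) F) = h * cochar c ϖ * k}

/-- The basic function `b = ∑_{j, k ≥ 0} q^{2j} 𝟙_{[P, P](F) (k + 2j)(ϖ) Sp₆(𝒪)}`, as a left
`[P, P](F)`-invariant function on `Sp₆(F)`; the sum is finite at every point. -/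
def basicFun (ϖ : F) (g : symplecticGroup (Fin 3) F) : ℂ :=
  ∑' j : ℕ, ∑' k : ℕ, (Nat.card 𝓀[F] : ℂ) ^ (2 * j) *
    (doubleCoset ϖ ((k : ℤ) + 2 * (j : ℤ))).indicator 1 g

end Basic

/-! ### The local integral -/

section Integral

variable {F : Type*} [NontriviallyNormedField F] [MeasurableSpace F]

/-- `dx` is the quotient measure on `N₀(F) \ G(F)` of the Haar measures `dg` and `dn`:
`∫_{G} f(g) dg = ∫_{N₀ \ G} ∫_{N₀} f(n x) dn dx` for all continuous compactly supported `f`. -/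
def IsQuotientMeasure [MeasurableSpace (SpecialLinearGroup (Fin 2) F)]
    (dg : Measure (G F)) (dn : Measure (N0 F)) (dx : Measure (N0Quot F)) : Prop :=
  ∀ f : G F → ℝ, Continuous f → HasCompactSupport f →
    ∫ g, f g ∂dg = ∫ x, ∫ n : N0 F, f ((n : G F) * Quotient.out x) ∂dn ∂dx

variable {d : Fin 3 → ℕ}

/-- The function `g ↦ f₁(γ₀ g) ρ(g)f₂(v)` on `N₀(F) \ G(F)`. It is evaluated on representatives;
for `v ∈ Y(F)` and `f₁` left `[P, P](F)`-invariant it does not depend on the representative. -/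
def integrand (ψ : AddChar F Circle) (J : (i : Fin 3) → Matrix (Fin (d i)) (Fin (d i)) F)
    (dt : (i : Fin 3) → Measure (Fin (d i) → F)) (f₁ : symplecticGroup (Fin 3) F → ℂ)
    (f₂ : V F d → ℂ) (v : V F d) (x : N0Quot F) : ℂ :=
  f₁ (gamma0 F * embedG (Quotient.out x)) * weilRep ψ J dt (Quotient.out x) f₂ v

/-- `I(f₁, f₂)(v) = ∫_{N₀(F) \ G(F)} f₁(γ₀ g) ρ(g)f₂(v) dg`. -/
def localIntegral [MeasurableSpace (SpecialLinearGroup (Fin 2) F)]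
    (ψ : AddChar F Circle) (J : (i : Fin 3) → Matrix (Fin (d i)) (Fin (d i)) F)
    (dt : (i : Fin 3) → Measure (Fin (d i) → F)) (dx : Measure (N0Quot F))
    (f₁ : symplecticGroup (Fin 3) F → ℂ) (f₂ : V F d → ℂ) (v : V F d) : ℂ :=
  ∫ x, integrand ψ J dt f₁ f₂ v x ∂dx

/-- The domain of integration: `a ∈ (𝒪 ∩ Fˣ)³` with
`max(|a₁⁻¹a₂a₃|, |a₂⁻¹a₁a₃|, |a₃⁻¹a₁a₂|) ≤ 1`. -/
def domainA (F : Type*) [NontriviallyNormedField F] [IsUltrametricDist F] : Set (Fin 3 → Fˣ) :=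
  {a | (∀ i, (a i : F) ∈ 𝒪[F]) ∧
    max (max ‖(a 0 : F)⁻¹ * a 1 * a 2‖ ‖(a 1 : F)⁻¹ * a 0 * a 2‖) ‖(a 2 : F)⁻¹ * a 0 * a 1‖ ≤ 1}

/-- The function of `a` integrated in the `j`-th summand of the formula, with `s` in the place of
`𝒬(v)`:
`𝟙_𝒪(s / (ϖ^{4j} a₁a₂a₃)) 𝟙_{V(𝒪)}(v / (ϖ^{2j} a)) χ̄_𝒬(ϖ^{2j} a) ∏ (|a_i| / q^{2j})^{1 - d_i/2}`. -/
def formulaTerm [IsUltrametricDist F]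
    (J : (i : Fin 3) → Matrix (Fin (d i)) (Fin (d i)) F) (ϖ : F) (s : F) (v : V F d)
    (j : ℕ) (a : Fin 3 → Fˣ) : ℂ :=
  (𝒪[F] : Set F).indicator 1 (s / (ϖ ^ (4 * j) * ((a 0 : F) * a 1 * a 2))) *
    (VO F d).indicator 1 (fun i => (ϖ ^ (2 * j) * (a i : F))⁻¹ • v i) *
    (starRingEnd ℂ) (chiQ J fun i => ϖ ^ (2 * j) * (a i : F)) *
    ∏ i, (((‖(a i : F)‖ / (Nat.card 𝓀[F] : ℝ) ^ (2 * j)) ^ (1 - (d i : ℝ) / 2) : ℝ) : ℂ)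

end Integral

end UnramifiedTriple

end

namespace UnramifiedTriple

section LocalField

variable {F : Type*} [NontriviallyNormedField F] [IsUltrametricDist F]

/-- A uniformizer of a field with discrete absolute value and finite residue field, the absolute
value being the normalized one. -/
structure IsNormalizedUniformizer (ϖ : F) : Prop where
  one_lt_card : 1 < Nat.card 𝓀[F]
  norm_eq : ‖ϖ‖ = (Nat.card 𝓀[F] : ℝ)⁻¹
  norm_le_of_lt_one : ∀ x : F, ‖x‖ < 1 → ‖x‖ ≤ ‖ϖ‖

theorem IsUnramifiedLocalField.isNormalizedUniformizer {p : ℕ} [h : IsUnramifiedLocalField p F]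
    {ϖ : 𝒪[F]} (hϖ : Irreducible ϖ) : IsNormalizedUniformizer (ϖ : F) := by
  have hmax : ∀ x : 𝒪[F], ‖(x : F)‖ < 1 → x ∈ 𝓂[F] := fun x hx => by
    rw [IsLocalRing.mem_maximalIdeal, mem_nonunits_iff]
    intro hu
    exact hx.ne (Valued.integer.isUnit_iff_norm_eq_one.mp hu)
  have hle : ∀ x : F, ‖x‖ < 1 → ‖x‖ ≤ ‖(p : F)‖ := fun x hx => by
    have := hmax ⟨x, Valued.integer.mem_iff.mpr hx.le⟩ hx
    rw [h.maximalIdeal_eq, Ideal.mem_span_singleton] at this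
    obtain ⟨y, hy⟩ := this
    have hxy : x = p * y := by simpa using congrArg Subtype.val hy
    rw [hxy, norm_mul]
    exact mul_le_of_le_one_right (norm_nonneg _) (Valued.integer.mem_iff.mp y.2)
  have hpos : 0 < ‖(ϖ : F)‖ := Valued.integer.norm_irreducible_pos hϖ
  have hlt : ‖(ϖ : F)‖ < 1 := Valued.integer.norm_irreducible_lt_one hϖ
  have hp_mem : (p : 𝒪[F]) ∈ 𝓂[F] := by
    rw [h.maximalIdeal_eq]; exact Ideal.mem_span_singleton_self _
  have hp1 : ‖(p : F)‖ < 1 := by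
    rw [IsLocalRing.mem_maximalIdeal, mem_nonunits_iff,
      Valued.integer.isUnit_iff_norm_eq_one] at hp_mem
    exact lt_of_le_of_ne (by simpa using Valued.integer.norm_le_one (p : 𝒪[F]))
      (by simpa using hp_mem)
  have heq : ‖(ϖ : F)‖ = ‖(p : F)‖ := by
    have h1 := hmax ϖ hlt
    rw [h.maximalIdeal_eq, Ideal.mem_span_singleton] at h1
    obtain ⟨y, hy⟩ := h1
    have hpu : ¬IsUnit (p : 𝒪[F]) := hp_mem
    have hyu : IsUnit y := (hϖ.isUnit_or_isUnit hy).resolve_left hpu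
    have hxy : (ϖ : F) = p * y := by simpa using congrArg Subtype.val hy
    have hy1 : ‖(y : F)‖ = 1 := Valued.integer.isUnit_iff_norm_eq_one.mp hyu
    rw [hxy, norm_mul, hy1, mul_one]
  refine ⟨?_, heq.trans h.norm_p, fun x hx => heq ▸ hle x hx⟩
  have h2 := h.norm_p
  rw [← heq] at h2
  have h3 : (0 : ℝ) < (Nat.card 𝓀[F] : ℝ)⁻¹ := h2 ▸ hpos
  have h4 : (Nat.card 𝓀[F] : ℝ)⁻¹ < 1 := h2 ▸ hlt
  have := (inv_lt_one₀ (inv_pos.mp h3)).mp h4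
  exact_mod_cast this

theorem IsUnramifiedLocalField.norm_three {p : ℕ} [h : IsUnramifiedLocalField p F]
    (hp : p ≠ 3) : ‖(3 : F)‖ = 1 := by
  have h3 : ‖(3 : F)‖ ≤ 1 := by exact_mod_cast Valued.integer.norm_le_one ((3 : ℕ) : 𝒪[F])
  refine le_antisymm h3 (le_of_not_gt fun hlt => ?_)
  have hp1 : ‖(p : F)‖ < 1 := by
    have hp_mem : (p : 𝒪[F]) ∈ 𝓂[F] := by
      rw [h.maximalIdeal_eq]; exact Ideal.mem_span_singleton_self _
    rw [IsLocalRing.mem_maximalIdeal, mem_nonunits_iff,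
      Valued.integer.isUnit_iff_norm_eq_one] at hp_mem
    exact lt_of_le_of_ne (by simpa using Valued.integer.norm_le_one (p : 𝒪[F]))
      (by simpa using hp_mem)
  have hcop : IsCoprime (p : ℤ) (3 : ℤ) := by
    have := (Nat.coprime_primes h.prime Nat.prime_three).mpr hp
    exact_mod_cast this.isCoprime
  obtain ⟨a, b, hab⟩ := hcop
  have hF : (a : F) * p + b * 3 = 1 := by exact_mod_cast congrArg (Int.cast (R := F)) hab
  have hint : ∀ n : ℤ, ‖(n : F)‖ ≤ 1 := fun n => by
    simpa using Valued.integer.norm_le_one (n : 𝒪[F])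
  have h1 : ‖(a : F) * p + b * 3‖ < 1 := by
    refine (IsUltrametricDist.norm_add_le_max _ _).trans_lt (max_lt ?_ ?_) <;> rw [norm_mul]
    · exact (mul_le_of_le_one_left (norm_nonneg _) (hint a)).trans_lt hp1
    · exact (mul_le_of_le_one_left (norm_nonneg _) (hint b)).trans_lt hlt
  rw [hF, norm_one] at h1
  exact h1.false

namespace IsNormalizedUniformizer

variable {ϖ : F} (h : IsNormalizedUniformizer ϖ)
include h

theorem norm_pos : 0 < ‖ϖ‖ := by
  rw [h.norm_eq]; have := h.one_lt_card; positivity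

theorem ne_zero : ϖ ≠ 0 := norm_pos_iff.mp h.norm_pos

theorem norm_lt_one : ‖ϖ‖ < 1 := by
  rw [h.norm_eq]; exact inv_lt_one_of_one_lt₀ (by exact_mod_cast h.one_lt_card)

theorem card_eq : (Nat.card 𝓀[F] : ℝ) = ‖ϖ‖⁻¹ := by rw [h.norm_eq, inv_inv]

theorem exists_zpow {x : F} (hx : x ≠ 0) : ∃ n : ℤ, ‖x‖ = ‖ϖ‖ ^ n := by
  obtain ⟨n, h1, h2⟩ := exists_mem_Ioc_zpow (norm_pos_iff.mpr hx)
    ((one_lt_inv₀ h.norm_pos).mpr h.norm_lt_one)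
  refine ⟨-(n + 1), le_antisymm (by simpa using h2) (le_of_not_gt fun hlt => ?_)⟩
  have h3 := h.norm_le_of_lt_one (x * ϖ ^ (n + 1)) (by
    rw [norm_mul, norm_zpow]
    calc ‖x‖ * ‖ϖ‖ ^ (n + 1) < ‖ϖ‖ ^ (-(n + 1)) * ‖ϖ‖ ^ (n + 1) :=
          mul_lt_mul_of_pos_right hlt (zpow_pos h.norm_pos _)
      _ = 1 := by rw [← zpow_add₀ h.norm_pos.ne']; simp)
  rw [norm_mul, norm_zpow, zpow_add_one₀ h.norm_pos.ne', ← mul_assoc] at h3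
  have h4 : ‖x‖ * ‖ϖ‖ ^ n ≤ 1 := by
    by_contra! hcon
    nlinarith [h.norm_pos]
  rw [_root_.inv_zpow] at h1
  have h5 := mul_lt_mul_of_pos_right h1 (zpow_pos h.norm_pos n)
  rw [inv_mul_cancel₀ (zpow_pos h.norm_pos n).ne'] at h5
  linarith

theorem zpow_le_zpow_iff {m n : ℤ} : ‖ϖ‖ ^ m ≤ ‖ϖ‖ ^ n ↔ n ≤ m :=
  zpow_le_zpow_iff_right_of_lt_one₀ h.norm_pos h.norm_lt_one

theorem zpow_inj {m n : ℤ} : ‖ϖ‖ ^ m = ‖ϖ‖ ^ n ↔ m = n :=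
  zpow_right_inj₀ h.norm_pos h.norm_lt_one.ne

/-- The ball of radius `|ϖ|ⁿ` is the disjoint union of the translates, indexed by the residue
field, of the ball of radius `|ϖ|ⁿ⁺¹`. -/
theorem exists_residue_representatives (n : ℤ) : ∃ u : 𝓀[F] → F, ∀ x,
    (‖x‖ ≤ ‖ϖ‖ ^ n → ∃! c, ‖-u c + x‖ ≤ ‖ϖ‖ ^ (n + 1)) ∧
      ∀ c, ‖-u c + x‖ ≤ ‖ϖ‖ ^ (n + 1) → ‖x‖ ≤ ‖ϖ‖ ^ n := by
  have hsurj : Function.Surjective (IsLocalRing.residue 𝒪[F]) := IsLocalRing.residue_surjective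
  choose s hs using hsurj
  have key : ∀ y z : 𝒪[F], IsLocalRing.residue 𝒪[F] y = IsLocalRing.residue 𝒪[F] z ↔
      ‖(y : F) - z‖ ≤ ‖ϖ‖ := fun y z => by
    rw [← sub_eq_zero, ← map_sub, IsLocalRing.residue_eq_zero_iff, IsLocalRing.mem_maximalIdeal,
      mem_nonunits_iff, Valued.integer.isUnit_iff_norm_eq_one]
    have h1 : ‖(y : F) - z‖ ≤ 1 := by simpa using Valued.integer.norm_le_one (y - z)
    have h2 : ‖y - z‖ = ‖(y : F) - z‖ := rfl
    rw [h2]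
    exact ⟨fun hne => h.norm_le_of_lt_one _ (lt_of_le_of_ne h1 hne),
      fun hle => (hle.trans_lt h.norm_lt_one).ne⟩
  have hscale : ∀ (c : 𝓀[F]) (x : F), ‖-(ϖ ^ n * (s c : F)) + x‖ ≤ ‖ϖ‖ ^ (n + 1) ↔
      ‖(ϖ ^ n)⁻¹ * x - s c‖ ≤ ‖ϖ‖ := fun c x => by
    have hne := zpow_ne_zero n h.ne_zero
    have : -(ϖ ^ n * (s c : F)) + x = ϖ ^ n * ((ϖ ^ n)⁻¹ * x - s c) := by
      field_simp; ring
    rw [this, norm_mul, norm_zpow, zpow_add_one₀ h.norm_pos.ne',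
      mul_le_mul_iff_right₀ (zpow_pos h.norm_pos n)]
  refine ⟨fun c => ϖ ^ n * s c, fun x => ⟨fun hx => ?_, ?_⟩⟩
  · have hy : ‖(ϖ ^ n)⁻¹ * x‖ ≤ 1 := by
      rw [norm_mul, norm_inv, norm_zpow, inv_mul_le_iff₀ (zpow_pos h.norm_pos n), mul_one]
      exact hx
    refine ⟨IsLocalRing.residue 𝒪[F] ⟨_, Valued.integer.mem_iff.mpr hy⟩, ?_, fun c hc => ?_⟩
    · exact (hscale _ _).mpr ((key ⟨_, Valued.integer.mem_iff.mpr hy⟩ _).mp (hs _).symm)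
    · rw [← hs c]
      exact ((key ⟨_, Valued.integer.mem_iff.mpr hy⟩ _).mpr ((hscale _ _).mp hc)).symm
  · intro c hc
    have h1 : ‖ϖ ^ n * (s c : F)‖ ≤ ‖ϖ‖ ^ n := by
      rw [norm_mul, norm_zpow]
      exact mul_le_of_le_one_right (zpow_pos h.norm_pos n).le (Valued.integer.mem_iff.mp (s c).2)
    have h2 : ‖ϖ‖ ^ (n + 1) ≤ ‖ϖ‖ ^ n := h.zpow_le_zpow_iff.mpr (by omega)
    have h3 : x = ϖ ^ n * (s c : F) + (-(ϖ ^ n * (s c : F)) + x) := by ring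
    rw [h3]
    exact (IsUltrametricDist.norm_add_le_max _ _).trans (max_le h1 (hc.trans h2))

end IsNormalizedUniformizer

/-- If a set is the disjoint union of finitely many left translates of a second one, then its
measure is the corresponding multiple. -/
@[to_additive measure_eq_card_mul_of_existsUnique_add]
theorem measure_eq_card_mul_of_existsUnique {H ι : Type*} [Group H] [MeasurableSpace H]
    [MeasurableMul H] [Finite ι] (μ : Measure H) [μ.IsMulLeftInvariant] {S S' : Set H}
    (hS' : MeasurableSet S') (u : ι → H)
    (hu : ∀ x, (x ∈ S → ∃! c, (u c)⁻¹ * x ∈ S') ∧ ∀ c, (u c)⁻¹ * x ∈ S' → x ∈ S) :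
    μ S = Nat.card ι * μ S' := by
  have := Fintype.ofFinite ι
  have h1 : S = ⋃ c, (fun x => (u c)⁻¹ * x) ⁻¹' S' := by
    ext x
    simp only [Set.mem_iUnion, Set.mem_preimage]
    exact ⟨fun hx => ((hu x).1 hx).exists, fun ⟨c, hc⟩ => (hu x).2 c hc⟩
  rw [h1, measure_iUnion]
  · simp [measure_preimage_mul, Nat.card_eq_fintype_card]
  · intro c c' hcc'
    refine Set.disjoint_left.mpr fun x hx hx' => hcc' ?_
    exact ((hu x).1 ((hu x).2 c hx)).unique hx hx'
  · exact fun c => hS'.preimage (measurable_const_mul _)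

theorem IsNormalizedUniformizer.eq_zpow_mul_of_step {ϖ : F} (h : IsNormalizedUniformizer ϖ)
    {f : ℤ → ENNReal} (hf : ∀ n, f n = Nat.card 𝓀[F] * f (n + 1)) (n : ℤ) :
    f n = ENNReal.ofReal (‖ϖ‖ ^ n) * f 0 := by
  have hstep : ∀ n, f n = ENNReal.ofReal ‖ϖ‖⁻¹ * f (n + 1) := fun n => by
    rw [← h.card_eq, ENNReal.ofReal_natCast]; exact hf n
  have hne : ENNReal.ofReal ‖ϖ‖⁻¹ ≠ 0 := by simpa using h.ne_zero
  induction n using Int.induction_on with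
  | zero => simp
  | succ n ih =>
    rw [hstep] at ih
    refine (ENNReal.mul_right_inj hne ENNReal.ofReal_ne_top).mp (ih.trans ?_)
    rw [← mul_assoc, ← ENNReal.ofReal_mul (by positivity), zpow_add_one₀ h.norm_pos.ne',
      mul_comm _ ‖ϖ‖, inv_mul_cancel_left₀ h.norm_pos.ne']
  | pred n ih =>
    rw [hstep, sub_add_cancel, ih, ← mul_assoc, ← ENNReal.ofReal_mul (by positivity),
      zpow_sub_one₀ h.norm_pos.ne', mul_comm ‖ϖ‖⁻¹]

theorem IsNormalizedUniformizer.finite_residueField {ϖ : F} (h : IsNormalizedUniformizer ϖ) :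
    Finite 𝓀[F] :=
  Nat.finite_of_card_ne_zero (by have := h.one_lt_card; omega)

theorem IsNormalizedUniformizer.measure_closedBall {ϖ : F} (h : IsNormalizedUniformizer ϖ)
    [MeasurableSpace F] [BorelSpace F] (ν : Measure F) [ν.IsAddLeftInvariant]
    [SecondCountableTopology F]
    (hν : ν {x | ‖x‖ ≤ 1} = 1) (n : ℤ) : ν {x | ‖x‖ ≤ ‖ϖ‖ ^ n} = ENNReal.ofReal (‖ϖ‖ ^ n) := by
  rw [h.eq_zpow_mul_of_step (f := fun n => ν {x | ‖x‖ ≤ ‖ϖ‖ ^ n}) (fun n => ?_) n]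
  · simp [hν]
  · obtain ⟨u, hu⟩ := h.exists_residue_representatives n
    have := h.finite_residueField
    exact measure_eq_card_mul_of_existsUnique_add ν
      (measurableSet_le measurable_norm measurable_const) u hu

end LocalField

section Hilbert

variable {F : Type*} [Field F]

theorem hilbertSym_eq_one_or (a b : F) : hilbertSym a b = 1 ∨ hilbertSym a b = -1 := by
  unfold hilbertSym; split_ifs <;> simp

theorem hilbertSym_of_isSquare {a b : F} (hb : IsSquare b) : hilbertSym a b = 1 := by
  obtain ⟨c, rfl⟩ := hb
  exact if_pos ⟨0, 1, c, by simp, by ring⟩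

theorem hilbertSym_eq_one_iff {a b : F} (hb : ¬IsSquare b) :
    hilbertSym a b = 1 ↔ ∃ y z : F, a = z ^ 2 - b * y ^ 2 := by
  unfold hilbertSym
  constructor
  · intro h
    split_ifs at h with hex
    obtain ⟨x, y, z, h0, h1⟩ := hex
    have hx : x ≠ 0 := by
      rintro rfl
      by_cases hy : y = 0
      · subst hy
        exact h0 ⟨rfl, rfl, by simpa using h1⟩
      · exact hb ⟨z / y, by field_simp; linear_combination -h1⟩
    exact ⟨y / x, z / x, by field_simp; linear_combination -h1⟩
  · rintro ⟨y, z, rfl⟩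
    exact if_pos ⟨1, y, z, by simp, by ring⟩

theorem hilbertSym_sq_mul (a b : F) {c : F} (hc : c ≠ 0) :
    hilbertSym (c ^ 2 * a) b = hilbertSym a b := by
  by_cases hb : IsSquare b
  · rw [hilbertSym_of_isSquare hb, hilbertSym_of_isSquare hb]
  · have : hilbertSym (c ^ 2 * a) b = 1 ↔ hilbertSym a b = 1 := by
      rw [hilbertSym_eq_one_iff hb, hilbertSym_eq_one_iff hb]
      constructor
      · rintro ⟨y, z, h⟩
        exact ⟨y / c, z / c, by field_simp; linear_combination h⟩
      · rintro ⟨y, z, h⟩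
        exact ⟨y * c, z * c, by linear_combination c ^ 2 * h⟩
    rcases hilbertSym_eq_one_or (c ^ 2 * a) b with h1 | h1 <;>
      rcases hilbertSym_eq_one_or a b with h2 | h2 <;> simp_all

theorem hilbertSym_mul_of_eq_one {a a' b : F} (h : hilbertSym a b = 1)
    (ha : a ≠ 0) : hilbertSym (a * a') b = hilbertSym a' b := by
  by_cases hb : IsSquare b
  · rw [hilbertSym_of_isSquare hb, hilbertSym_of_isSquare hb]
  · have hmul : ∀ c, hilbertSym c b = 1 → hilbertSym (a * c) b = 1 := by
      intro c hc
      rw [hilbertSym_eq_one_iff hb] at h hc ⊢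
      obtain ⟨y, z, h⟩ := h
      obtain ⟨y', z', hc⟩ := hc
      exact ⟨z * y' + y * z', z * z' + b * y * y', by rw [h, hc]; ring⟩
    have : hilbertSym (a * a') b = 1 ↔ hilbertSym a' b = 1 := by
      refine ⟨fun h1 => ?_, hmul a'⟩
      have := hmul _ h1
      rwa [← mul_assoc, ← pow_two, hilbertSym_sq_mul _ _ ha] at this
    rcases hilbertSym_eq_one_or (a * a') b with h1 | h1 <;>
      rcases hilbertSym_eq_one_or a' b with h2 | h2 <;> simp_all

end Hilbert

section UnramifiedCharacter

theorem chi_eq_one_or {F : Type*} [Field F] {n : ℕ} (J : Matrix (Fin n) (Fin n) F) (a : F) :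
    chi J a = 1 ∨ chi J a = -1 :=
  hilbertSym_eq_one_or _ _

theorem chi_inv {F : Type*} [Field F] {n : ℕ} (J : Matrix (Fin n) (Fin n) F) {a : F}
    (ha : a ≠ 0) : chi J a⁻¹ = chi J a := by
  have := hilbertSym_sq_mul a⁻¹ ((-1) ^ (n / 2) * J.det) ha
  rw [pow_two, mul_inv_cancel_right₀ ha] at this
  exact this.symm

theorem chi_one {F : Type*} [Field F] {n : ℕ} (J : Matrix (Fin n) (Fin n) F) : chi J 1 = 1 :=
  if_pos ⟨1, 0, 1, by simp, by simp⟩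

theorem chi_eq_of_norm_eq {F : Type*} [NontriviallyNormedField F] {n : ℕ}
    {J : Matrix (Fin n) (Fin n) F} (hJ : ∀ u, ‖u‖ = 1 → chi J u = 1) {a b : F} (hb : b ≠ 0)
    (hab : ‖a‖ = ‖b‖) : chi J a = chi J b := by
  have hu : ‖a / b‖ = 1 := by rw [norm_div, hab, div_self (norm_ne_zero_iff.mpr hb)]
  have := hilbertSym_mul_of_eq_one (a' := b) (hJ _ hu) (norm_ne_zero_iff.mp (by simp [hu]))
  rwa [div_mul_cancel₀ _ hb] at this

/-- If the product character is unramified, so are its factors. -/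
theorem chi_eq_one_of_chiQ {F : Type*} [NontriviallyNormedField F]
    {d : Fin 3 → ℕ}
    {J : (i : Fin 3) → Matrix (Fin (d i)) (Fin (d i)) F}
    (hχ : ∀ u : Fin 3 → F, (∀ i, ‖u i‖ = 1) → chiQ J u = 1) (i : Fin 3) {u : F} (hu : ‖u‖ = 1) :
    chi (J i) u = 1 := by
  have h1 := hχ (Function.update 1 i u) (fun j => by
    by_cases hj : j = i
    · subst hj; simpa
    · simp [hj])
  rw [chiQ, Finset.prod_eq_single i (fun j _ hj => by simp [hj, chi_one]) (by simp)] at h1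
  simpa using h1

variable {F : Type*} [NontriviallyNormedField F] [IsUltrametricDist F] {n : ℕ}
  {J : Matrix (Fin n) (Fin n) F}

theorem chi_mul {ϖ : F} (h : IsNormalizedUniformizer ϖ) (hJ : ∀ u, ‖u‖ = 1 → chi J u = 1)
    {a b : F} (ha : a ≠ 0) (hb : b ≠ 0) : chi J (a * b) = chi J a * chi J b := by
  rcases chi_eq_one_or J a with h1 | h1
  · rw [h1, one_mul]; exact hilbertSym_mul_of_eq_one h1 ha
  rcases chi_eq_one_or J b with h2 | h2
  · rw [h2, mul_one, mul_comm]; exact hilbertSym_mul_of_eq_one h2 hb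
  have hodd : ∀ c : F, c ≠ 0 → chi J c = -1 → ∃ m : ℤ, ‖c‖ = ‖ϖ ^ (2 * m + 1)‖ := by
    intro c hc hc1
    obtain ⟨k, hk⟩ := h.exists_zpow hc
    rcases Int.even_or_odd' k with ⟨m, rfl | rfl⟩
    · have h3 : chi J c = chi J ((ϖ ^ m) ^ 2 * 1) := by
        refine chi_eq_of_norm_eq hJ (by simpa using zpow_ne_zero m h.ne_zero) ?_
        rw [hk, mul_one, norm_pow, norm_zpow, two_mul, zpow_add₀ h.norm_pos.ne', pow_two]
      have h4 : chi J ((ϖ ^ m) ^ 2 * 1) = chi J 1 :=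
        hilbertSym_sq_mul _ _ (zpow_ne_zero m h.ne_zero)
      rw [h3, h4, hJ 1 norm_one] at hc1
      norm_num at hc1
    · exact ⟨m, by rw [hk, norm_zpow]⟩
  obtain ⟨k, hk⟩ := hodd a ha h1
  obtain ⟨l, hl⟩ := hodd b hb h2
  have h3 : chi J (a * b) = chi J ((ϖ ^ (k + l + 1)) ^ 2 * 1) := by
    refine chi_eq_of_norm_eq hJ (by simpa using zpow_ne_zero _ h.ne_zero) ?_
    rw [mul_one, norm_mul, hk, hl, ← norm_mul, ← zpow_add₀ h.ne_zero, ← zpow_natCast,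
      ← _root_.zpow_mul]
    congr 2; push_cast; ring
  have h4 : chi J ((ϖ ^ (k + l + 1)) ^ 2 * 1) = chi J 1 :=
    hilbertSym_sq_mul _ _ (zpow_ne_zero _ h.ne_zero)
  rw [h3, h4, hJ 1 norm_one, h1, h2]; norm_num

end UnramifiedCharacter

section CharacterSum

variable {F : Type*} [NontriviallyNormedField F] [IsUltrametricDist F]

theorem norm_sub_le_max_norm (x y : F) : ‖x - y‖ ≤ max ‖x‖ ‖y‖ := by
  simpa [sub_eq_add_neg] using IsUltrametricDist.norm_add_le_max x (-y)

/-- `T` is a set of representatives of the ball of radius `R` modulo the ball of radius `r`. -/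
structure IsBallTransversal (R r : ℝ) (T : Finset F) : Prop where
  norm_le : ∀ t ∈ T, ‖t‖ ≤ R
  existsUnique : ∀ x : F, ‖x‖ ≤ R → ∃! t, t ∈ T ∧ ‖x - t‖ ≤ r

theorem exists_isBallTransversal [ProperSpace F] {R r : ℝ} (hr : 0 < r) (hR : r ≤ R) :
    ∃ T : Finset F, IsBallTransversal R r T := by
  let s : Setoid F :=
    ⟨fun x y => ‖x - y‖ ≤ r, fun x => by simpa using hr.le,
      fun {x y} hxy => by rwa [norm_sub_rev], fun {x y z} hxy hyz => by
        have h1 : x - z = (x - y) + (y - z) := by ring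
        rw [h1]
        exact (IsUltrametricDist.norm_add_le_max _ _).trans (max_le hxy hyz)⟩
  let f : F → F := fun x => (Quotient.mk s x).out
  have hf : ∀ x, ‖f x - x‖ ≤ r := fun x => Quotient.mk_out (s := s) x
  have hf' : ∀ x y, ‖x - y‖ ≤ r → f x = f y := fun x y hxy =>
    congrArg Quotient.out (Quotient.sound (s := s) hxy)
  have hfin : (f '' Metric.closedBall 0 R).Finite := by
    obtain ⟨t, ht, hcov⟩ := Metric.totallyBounded_iff.mp
      (isCompact_closedBall (0 : F) R).totallyBounded r hr
    refine (ht.image f).subset ?_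
    rintro _ ⟨x, hx, rfl⟩
    obtain ⟨y, hy, hxy⟩ := Set.mem_iUnion₂.mp (hcov hx)
    exact ⟨y, hy, (hf' x y (by simpa [dist_eq_norm] using (Metric.mem_ball.mp hxy).le)).symm⟩
  refine ⟨hfin.toFinset, ⟨fun t ht => ?_, fun x hx => ⟨f x, ⟨?_, ?_⟩, ?_⟩⟩⟩
  · obtain ⟨x, hx, rfl⟩ := hfin.mem_toFinset.mp ht
    have h1 : f x = (f x - x) + x := by ring
    rw [h1]
    exact (IsUltrametricDist.norm_add_le_max _ _).trans
      (max_le ((hf x).trans hR) (by simpa using hx))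
  · exact hfin.mem_toFinset.mpr ⟨x, by simpa using hx, rfl⟩
  · rw [norm_sub_rev]; exact hf x
  · rintro t ⟨ht, htx⟩
    obtain ⟨y, hy, rfl⟩ := hfin.mem_toFinset.mp ht
    refine hf' y x ?_
    have h1 : y - x = -(f y - y) + -(x - f y) := by ring
    rw [h1]
    exact (IsUltrametricDist.norm_add_le_max _ _).trans (max_le (by rw [norm_neg]; exact hf y)
      (by rwa [norm_neg]))

theorem IsBallTransversal.filter {R r R' : ℝ} {T : Finset F} (hT : IsBallTransversal R r T)
    (h1 : r ≤ R') (h2 : R' ≤ R) : IsBallTransversal R' r (T.filter fun t => ‖t‖ ≤ R') := by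
  refine ⟨fun t ht => (Finset.mem_filter.mp ht).2, fun x hx => ?_⟩
  obtain ⟨t, ⟨ht, hxt⟩, huniq⟩ := hT.existsUnique x (hx.trans h2)
  refine ⟨t, ⟨Finset.mem_filter.mpr ⟨ht, ?_⟩, hxt⟩, fun t' ht' =>
    huniq t' ⟨(Finset.mem_filter.mp ht'.1).1, ht'.2⟩⟩
  have h3 : t = x - (x - t) := by ring
  rw [h3]
  exact (norm_sub_le_max_norm _ _).trans (max_le hx (hxt.trans h1))

theorem IsBallTransversal.card_mul {ϖ : F} (h : IsNormalizedUniformizer ϖ) [ProperSpace F]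
    {M N : ℤ} {T : Finset F} (hT : IsBallTransversal (‖ϖ‖ ^ M) (‖ϖ‖ ^ N) T)
    (hMN : M ≤ N) : (T.card : ℝ) * ‖ϖ‖ ^ N = ‖ϖ‖ ^ M := by
  let _ : MeasurableSpace F := borel F
  have : BorelSpace F := ⟨rfl⟩
  let K₀ : TopologicalSpace.PositiveCompacts F := ⟨⟨Metric.closedBall 0 1,
    isCompact_closedBall _ _⟩, ⟨0, mem_interior_iff_mem_nhds.mpr
      (Metric.closedBall_mem_nhds 0 one_pos)⟩⟩
  let ν : Measure F := Measure.addHaarMeasure K₀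
  have hν : ν {x | ‖x‖ ≤ 1} = 1 := by
    have : {x : F | ‖x‖ ≤ 1} = K₀ := by ext x; exact (mem_closedBall_zero_iff (a := x)).symm
    rw [this]; exact Measure.addHaarMeasure_self
  have key := measure_eq_card_mul_of_existsUnique_add ν (S := {x | ‖x‖ ≤ ‖ϖ‖ ^ M})
    (S' := {x | ‖x‖ ≤ ‖ϖ‖ ^ N}) (measurableSet_le measurable_norm measurable_const)
    (fun t : T => (t : F)) (fun x => ⟨fun hx => ?_, fun t ht => ?_⟩)
  · rw [h.measure_closedBall ν hν, h.measure_closedBall ν hν] at key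
    have := congrArg ENNReal.toReal key
    rw [ENNReal.toReal_mul, ENNReal.toReal_ofReal (zpow_pos h.norm_pos _).le,
      ENNReal.toReal_ofReal (zpow_pos h.norm_pos _).le] at this
    simpa using this.symm
  · obtain ⟨t, ⟨ht, hxt⟩, huniq⟩ := hT.existsUnique x hx
    refine ⟨⟨t, ht⟩, by simpa [neg_add_eq_sub] using hxt, fun t' ht' => Subtype.ext ?_⟩
    exact huniq _ ⟨t'.2, by simpa [neg_add_eq_sub] using ht'⟩
  · have h3 : x = t + (-t + x) := by ring
    show ‖x‖ ≤ _
    rw [h3]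
    exact (IsUltrametricDist.norm_add_le_max _ _).trans
      (max_le (hT.norm_le _ t.2) (le_trans ht (h.zpow_le_zpow_iff.mpr hMN)))

theorem IsUnramifiedChar.eq_one {ψ : AddChar F Circle} (hψ : IsUnramifiedChar ψ) {x : F}
    (hx : ‖x‖ ≤ 1) : ψ x = 1 := by
  simpa using (hψ.conductor x).mpr (Valued.integer.mem_iff.mpr hx) 1 (one_mem _)

open Classical in
theorem IsBallTransversal.sum_addChar {ϖ : F} (h : IsNormalizedUniformizer ϖ) [ProperSpace F]
    {ψ : AddChar F Circle} (hψ : IsUnramifiedChar ψ) {M N : ℤ} {T : Finset F}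
    (hT : IsBallTransversal (‖ϖ‖ ^ M) (‖ϖ‖ ^ N) T) (hMN : M ≤ N) {s : F}
    (hs : ‖s‖ * ‖ϖ‖ ^ N ≤ 1) :
    (∑ t ∈ T, (ψ (t * s) : ℂ)) * ((‖ϖ‖ ^ N : ℝ) : ℂ) =
      if ‖s‖ * ‖ϖ‖ ^ M ≤ 1 then ((‖ϖ‖ ^ M : ℝ) : ℂ) else 0 := by
  split_ifs with hM
  · rw [Finset.sum_congr rfl fun t ht => (by
      rw [hψ.eq_one, Circle.coe_one]
      rw [norm_mul, mul_comm]
      exact (mul_le_mul_of_nonneg_left (hT.norm_le t ht) (norm_nonneg _)).trans hM :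
        (ψ (t * s) : ℂ) = 1)]
    rw [← hT.card_mul h hMN]
    simp
  · suffices ∑ t ∈ T, (ψ (t * s) : ℂ) = 0 by rw [this, zero_mul]
    obtain ⟨y, hy, hy1⟩ : ∃ y ∈ 𝒪[F], ψ (s * ϖ ^ M * y) ≠ 1 := by
      by_contra! hcon
      have := Valued.integer.mem_iff.mp ((hψ.conductor (s * ϖ ^ M)).mp hcon)
      rw [norm_mul, norm_zpow] at this
      exact hM this
    set t₁ := ϖ ^ M * y with ht₁
    have ht₁R : ‖t₁‖ ≤ ‖ϖ‖ ^ M := by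
      rw [ht₁, norm_mul, norm_zpow]
      exact mul_le_of_le_one_right (zpow_pos h.norm_pos _).le (Valued.integer.mem_iff.mp hy)
    choose! τ hτ hτu using hT.existsUnique
    have hper : ∀ x, ‖x‖ ≤ ‖ϖ‖ ^ M → ψ (τ x * s) = ψ (x * s) := fun x hx => by
      have h1 : x * s = τ x * s + (x - τ x) * s := by ring
      rw [h1, AddChar.map_add_eq_mul, hψ.eq_one (x := (x - τ x) * s), mul_one]
      rw [norm_mul, mul_comm]
      exact (mul_le_mul_of_nonneg_left (hτ x hx).2 (norm_nonneg _)).trans hs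
    have hadd : ∀ t ∈ T, ‖t + t₁‖ ≤ ‖ϖ‖ ^ M := fun t ht =>
      (IsUltrametricDist.norm_add_le_max _ _).trans (max_le (hT.norm_le t ht) ht₁R)
    have hsub : ∀ t ∈ T, ‖t - t₁‖ ≤ ‖ϖ‖ ^ M := fun t ht =>
      (norm_sub_le_max_norm _ _).trans (max_le (hT.norm_le t ht) ht₁R)
    have hinv : ∑ t ∈ T, (ψ (t * s) : ℂ) = (ψ (t₁ * s) : ℂ) * ∑ t ∈ T, (ψ (t * s) : ℂ) := by
      rw [Finset.mul_sum]
      symm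
      refine Finset.sum_bij' (fun t _ => τ (t + t₁)) (fun t _ => τ (t - t₁))
        (fun t ht => (hτ _ (hadd t ht)).1) (fun t ht => (hτ _ (hsub t ht)).1)
        (fun t ht => ?_) (fun t ht => ?_) (fun t ht => ?_)
      · have h2 := hτ _ (hadd t ht)
        refine (hτu _ (hsub _ h2.1) t ⟨ht, ?_⟩).symm
        rw [sub_right_comm, norm_sub_rev, ← sub_add, sub_add_eq_add_sub, add_comm t₁]
        exact h2.2
      · have h2 := hτ _ (hsub t ht)
        refine (hτu _ (hadd _ h2.1) t ⟨ht, ?_⟩).symm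
        rw [norm_sub_rev, ← sub_sub, sub_right_comm]
        exact h2.2
      · rw [hper _ (hadd t ht), add_mul, AddChar.map_add_eq_mul, Circle.coe_mul, mul_comm]
    have hne : (ψ (t₁ * s) : ℂ) ≠ 1 := by
      rw [Ne, Circle.coe_eq_one, ht₁]
      convert hy1 using 3; ring
    have h3 : (1 - (ψ (t₁ * s) : ℂ)) * ∑ t ∈ T, (ψ (t * s) : ℂ) = 0 := by
      linear_combination hinv
    exact (mul_eq_zero.mp h3).resolve_left (sub_ne_zero.mpr hne.symm)

end CharacterSum

section Borel

variable {F : Type*} [Field F]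

/-- The element `(1 t; 0 1) (a 0; 0 a⁻¹)` of `SL₂`. -/
def borel (t : F) (a : Fˣ) : SpecialLinearGroup (Fin 2) F :=
  ⟨!![(a : F), t * (a : F)⁻¹; 0, (a : F)⁻¹], by simp [det_fin_two]⟩

/-- The elements `(1 t_i; 0 1) (a_i 0; 0 a_i⁻¹)` of `SL₂³`. -/
def borelG (t : Fin 3 → F) (a : Fin 3 → Fˣ) : G F := fun i => borel (t i) (a i)

@[simp] theorem borel_coe (t : F) (a : Fˣ) : (borel t a : Matrix (Fin 2) (Fin 2) F) =
    !![(a : F), t * (a : F)⁻¹; 0, (a : F)⁻¹] := rfl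

theorem borel_mul_apply (t : F) (a : Fˣ) (k : SpecialLinearGroup (Fin 2) F) (s : Fin 2) :
    (borel t a * k) 0 s = a * k 0 s + t * (a : F)⁻¹ * k 1 s ∧
      (borel t a * k) 1 s = (a : F)⁻¹ * k 1 s := by
  constructor <;>
  simp [Matrix.mul_apply, Fin.sum_univ_two]

theorem borel_mul_borel_one (s t : F) (a : Fˣ) : borel s 1 * borel t a = borel (s + t) a := by
  ext i j
  fin_cases i <;> fin_cases j <;> simp [Matrix.mul_apply, Fin.sum_univ_two]
  ring

theorem mem_N0_iff {g : G F} : g ∈ N0 F ↔ ∃ t : Fin 3 → F, ∑ i, t i = 0 ∧ g = borelG t 1 := by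
  constructor
  · rintro ⟨t, ht, hg⟩
    refine ⟨t, ht, funext fun i => Subtype.ext ?_⟩
    rw [hg i]; simp [borelG]
  · rintro ⟨t, ht, rfl⟩
    exact ⟨t, ht, fun i => by simp [borelG]⟩

theorem borelG_one_mem_N0 {t : Fin 3 → F} (ht : ∑ i, t i = 0) : borelG t 1 ∈ N0 F :=
  mem_N0_iff.mpr ⟨t, ht, rfl⟩

theorem borelG_one_mul (s t : Fin 3 → F) (a : Fin 3 → Fˣ) :
    borelG s 1 * borelG t a = borelG (s + t) a :=
  funext fun i => borel_mul_borel_one (s i) (t i) (a i)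

end Borel

section Iwasawa

variable {F : Type*} [NontriviallyNormedField F] [IsUltrametricDist F]

variable (F) in
/-- `SL₂(𝒪)³` as a subgroup. -/
def integralG : Subgroup (G F) where
  carrier := GO F
  mul_mem' := by
    intro a b ha hb i r s
    change ((a i * b i : SpecialLinearGroup (Fin 2) F) : Matrix (Fin 2) (Fin 2) F) r s ∈ 𝒪[F]
    rw [Matrix.SpecialLinearGroup.coe_mul, Matrix.mul_apply]
    exact sum_mem fun l _ => mul_mem (ha i r l) (hb i l s)
  one_mem' := by
    intro i r s
    change ((1 : SpecialLinearGroup (Fin 2) F) : Matrix (Fin 2) (Fin 2) F) r s ∈ 𝒪[F]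
    rw [Matrix.SpecialLinearGroup.coe_one, Matrix.one_apply]
    split_ifs
    exacts [one_mem _, zero_mem _]
  inv_mem' := by
    intro a ha i r s
    change (((a i)⁻¹ : SpecialLinearGroup (Fin 2) F) : Matrix (Fin 2) (Fin 2) F) r s ∈ 𝒪[F]
    rw [Matrix.SpecialLinearGroup.coe_inv, adjugate_fin_two]
    fin_cases r <;> fin_cases s <;> simp [ha i 0 0, ha i 1 0, ha i 0 1, ha i 1 1]

theorem mem_integralG {g : G F} : g ∈ integralG F ↔ ∀ i r s, ‖g i r s‖ ≤ 1 := by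
  show (∀ i r s, g i r s ∈ 𝒪[F]) ↔ _
  simp only [Valued.integer.mem_iff]

theorem IsNormalizedUniformizer.exists_iwasawa {ϖ : F} (h : IsNormalizedUniformizer ϖ)
    (g : SpecialLinearGroup (Fin 2) F) : ∃ (t : F) (n : ℤ) (k : SpecialLinearGroup (Fin 2) F),
      (∀ r s, ‖k r s‖ ≤ 1) ∧ g = borel t (Units.mk0 ϖ h.ne_zero ^ n) * k := by
  have hdet : g 0 0 * g 1 1 - g 0 1 * g 1 0 = 1 := by rw [← det_fin_two]; exact g.2
  have key : ∀ c d : F, g 1 0 * d - g 1 1 * c = 0 → ‖c‖ ≤ 1 → ‖d‖ ≤ 1 → (‖c‖ = 1 ∨ ‖d‖ = 1) →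
      ∃ x y : F, ‖x‖ ≤ 1 ∧ ‖y‖ ≤ 1 ∧ x * d - y * c = 1 := by
    rintro c d - hc hd (h1 | h1)
    · refine ⟨0, -c⁻¹, by simp, by simp [h1], ?_⟩
      have : c ≠ 0 := norm_pos_iff.mp (h1 ▸ one_pos)
      field_simp; ring
    · refine ⟨d⁻¹, 0, by simp [h1], by simp, ?_⟩
      have : d ≠ 0 := norm_pos_iff.mp (h1 ▸ one_pos)
      field_simp; ring
  have hn : ∃ n : ℤ, ‖g 1 0‖ ≤ ‖ϖ‖ ^ n ∧ ‖g 1 1‖ ≤ ‖ϖ‖ ^ n ∧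
      (‖g 1 0‖ = ‖ϖ‖ ^ n ∨ ‖g 1 1‖ = ‖ϖ‖ ^ n) := by
    rcases le_total ‖g 1 0‖ ‖g 1 1‖ with hle | hle
    · have hne : g 1 1 ≠ 0 := fun h0 => by
        have h1 : g 1 0 = 0 := by simpa [h0] using hle
        simp [h0, h1] at hdet
      obtain ⟨n, hn⟩ := h.exists_zpow hne
      exact ⟨n, hn ▸ hle, hn.le, Or.inr hn⟩
    · have hne : g 1 0 ≠ 0 := fun h0 => by
        have h1 : g 1 1 = 0 := by simpa [h0] using hle
        simp [h0, h1] at hdet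
      obtain ⟨n, hn⟩ := h.exists_zpow hne
      exact ⟨n, hn.le, hn ▸ hle, Or.inl hn⟩
  obtain ⟨n, h0, h1, h01⟩ := hn
  have hw : ϖ ^ n ≠ 0 := zpow_ne_zero n h.ne_zero
  have hsc : ∀ x : F, ‖(ϖ ^ n)⁻¹ * x‖ = (‖ϖ‖ ^ n)⁻¹ * ‖x‖ := fun x => by
    rw [norm_mul, norm_inv, norm_zpow]
  have hp := zpow_pos h.norm_pos n
  obtain ⟨x, y, hx, hy, hxy⟩ := key ((ϖ ^ n)⁻¹ * g 1 0) ((ϖ ^ n)⁻¹ * g 1 1) (by ring)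
    (by rw [hsc, inv_mul_le_iff₀ hp, mul_one]; exact h0)
    (by rw [hsc, inv_mul_le_iff₀ hp, mul_one]; exact h1)
    (by rw [hsc, hsc, inv_mul_eq_one₀ hp.ne', inv_mul_eq_one₀ hp.ne']
        exact h01.imp Eq.symm Eq.symm)
  let k : SpecialLinearGroup (Fin 2) F :=
    ⟨!![x, y; (ϖ ^ n)⁻¹ * g 1 0, (ϖ ^ n)⁻¹ * g 1 1], by rw [det_fin_two]; simpa using hxy⟩
  refine ⟨(ϖ ^ n)⁻¹ * (g 0 1 * x - g 0 0 * y), -n, k, ?_, ?_⟩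
  · intro r s
    fin_cases r <;> fin_cases s
    · simpa [k] using hx
    · simpa [k] using hy
    · change ‖(ϖ ^ n)⁻¹ * g 1 0‖ ≤ 1
      rw [hsc, inv_mul_le_iff₀ hp, mul_one]; exact h0
    · simpa [k, hsc, inv_mul_le_iff₀ hp] using h1
  · have hcoe : ((Units.mk0 ϖ h.ne_zero ^ (-n) : Fˣ) : F) = (ϖ ^ n)⁻¹ := by simp
    have e1 : x * g 1 1 - y * g 1 0 = ϖ ^ n := by
      field_simp at hxy; linear_combination hxy
    ext r s
    fin_cases r
    · rw [Fin.zero_eta, (borel_mul_apply _ _ _ _).1, hcoe, inv_inv]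
      fin_cases s
      · change g 0 0 = (ϖ ^ n)⁻¹ * x + (ϖ ^ n)⁻¹ * (g 0 1 * x - g 0 0 * y) * ϖ ^ n *
          ((ϖ ^ n)⁻¹ * g 1 0)
        field_simp
        linear_combination (-g 0 0) * e1 + x * hdet
      · change g 0 1 = (ϖ ^ n)⁻¹ * y + (ϖ ^ n)⁻¹ * (g 0 1 * x - g 0 0 * y) * ϖ ^ n *
          ((ϖ ^ n)⁻¹ * g 1 1)
        field_simp
        linear_combination (-g 0 1) * e1 + y * hdet
    · rw [Fin.mk_one, (borel_mul_apply _ _ _ _).2, hcoe, inv_inv]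
      fin_cases s
      · exact (mul_inv_cancel_left₀ hw _).symm
      · exact (mul_inv_cancel_left₀ hw _).symm

end Iwasawa

section Radius

variable {F : Type*} [NontriviallyNormedField F]

/-- `max |a_i|²`. -/
def radius (a : Fin 3 → Fˣ) : ℝ := ‖fun i => (a i : F)‖ ^ 2

theorem exists_radius_eq (a : Fin 3 → Fˣ) :
    ∃ i, radius a = ‖(a i : F)‖ ^ 2 ∧ ∀ j, ‖(a j : F)‖ ≤ ‖(a i : F)‖ := by
  obtain ⟨i, hi⟩ := Finite.exists_max fun i => ‖(a i : F)‖
  refine ⟨i, ?_, hi⟩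
  rw [radius, le_antisymm ((pi_norm_le_iff_of_nonneg (norm_nonneg _)).mpr hi)
    (norm_le_pi_norm (fun i => (a i : F)) i)]

theorem norm_sq_le_radius (a : Fin 3 → Fˣ) (i : Fin 3) : ‖(a i : F)‖ ^ 2 ≤ radius a :=
  pow_le_pow_left₀ (norm_nonneg _) (norm_le_pi_norm (fun i => (a i : F)) i) 2

end Radius

section Cell

variable {F : Type*} [NontriviallyNormedField F] [IsUltrametricDist F]

/-- The double coset `N₀(F) g SL₂(𝒪)³`. -/
def cell (g : G F) : Set (G F) := {x | ∃ n ∈ N0 F, ∃ k ∈ integralG F, x = n * g * k}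

theorem borelG_mem_iff {t t' : Fin 3 → F} {a a' : Fin 3 → Fˣ} :
    (borelG t a)⁻¹ * borelG t' a' ∈ integralG F ↔
      (∀ i, ‖(a' i : F)‖ = ‖(a i : F)‖) ∧ ∀ i, ‖t' i - t i‖ ≤ ‖(a i : F)‖ ^ 2 := by
  have hentry : ∀ i, (((borelG t a)⁻¹ * borelG t' a') i : Matrix (Fin 2) (Fin 2) F) =
      !![(a i : F)⁻¹ * a' i, (t' i - t i) * (a i : F)⁻¹ * (a' i : F)⁻¹; 0,
        (a i : F) * (a' i : F)⁻¹] := fun i => by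
    change (((borel (t i) (a i))⁻¹ * borel (t' i) (a' i) : SpecialLinearGroup (Fin 2) F) :
      Matrix (Fin 2) (Fin 2) F) = _
    rw [Matrix.SpecialLinearGroup.coe_mul, Matrix.SpecialLinearGroup.coe_inv]
    simp only [borel_coe, adjugate_fin_two_of]
    ext r s
    fin_cases r <;> fin_cases s <;> simp [Matrix.mul_apply, Fin.sum_univ_two]
    ring
  rw [mem_integralG, ← forall_and]
  refine forall_congr' fun i => ?_
  rw [hentry]
  have ha : 0 < ‖(a i : F)‖ := norm_pos_iff.mpr (a i).ne_zero
  have ha' : 0 < ‖(a' i : F)‖ := norm_pos_iff.mpr (a' i).ne_zero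
  simp only [Fin.forall_fin_two, of_apply, cons_val_zero, cons_val_one, norm_mul, norm_inv,
    norm_zero, zero_le_one, true_and, Fin.isValue, cons_val_fin_one]
  rw [inv_mul_le_iff₀ ha, mul_one, mul_inv_le_iff₀ ha', one_mul, mul_inv_le_iff₀ ha',
    mul_inv_le_iff₀ ha, one_mul]
  constructor
  · rintro ⟨⟨h1, h2⟩, h3⟩
    have h4 := le_antisymm h1 h3
    exact ⟨h4, by rw [h4] at h2; rwa [pow_two]⟩
  · rintro ⟨h1, h2⟩
    rw [h1, ← pow_two]
    exact ⟨⟨le_rfl, h2⟩, le_rfl⟩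

theorem borelG_mul_mem_cell_iff {t t' : Fin 3 → F} {a a' : Fin 3 → Fˣ} {k : G F}
    (hk : k ∈ integralG F) : borelG t' a' * k ∈ cell (borelG t a) ↔
      (∀ i, ‖(a' i : F)‖ = ‖(a i : F)‖) ∧ ‖∑ i, t' i - ∑ i, t i‖ ≤ radius a := by
  constructor
  · rintro ⟨n, hn, k', hk', h⟩
    obtain ⟨s, hs, rfl⟩ := mem_N0_iff.mp hn
    rw [borelG_one_mul] at h
    have h1 : (borelG (s + t) a)⁻¹ * borelG t' a' ∈ integralG F := by
      have : (borelG (s + t) a)⁻¹ * borelG t' a' = k' * k⁻¹ := by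
        rw [inv_mul_eq_iff_eq_mul, ← mul_assoc, ← h, mul_inv_cancel_right]
      rw [this]; exact mul_mem hk' (inv_mem hk)
    obtain ⟨h2, h3⟩ := borelG_mem_iff.mp h1
    refine ⟨h2, ?_⟩
    have h4 : ∑ i, t' i - ∑ i, t i = ∑ i, (t' i - (s + t) i) := by
      simp [Finset.sum_sub_distrib, Finset.sum_add_distrib, hs]
    rw [h4]
    obtain ⟨i, -, hi⟩ := IsUltrametricDist.exists_norm_finsetSum_le_of_nonempty
      (t := Finset.univ) ⟨0, Finset.mem_univ _⟩ fun i => t' i - (s + t) i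
    exact hi.trans ((h3 i).trans (norm_sq_le_radius a i))
  · rintro ⟨h1, h2⟩
    obtain ⟨i, hi, -⟩ := exists_radius_eq a
    let s : Fin 3 → F := t' - t - Pi.single i (∑ i, t' i - ∑ i, t i)
    have hs : ∑ j, s j = 0 := by
      simp [s, Finset.sum_sub_distrib]
    have h3 : (borelG (s + t) a)⁻¹ * borelG t' a' ∈ integralG F := by
      refine borelG_mem_iff.mpr ⟨h1, fun j => ?_⟩
      have : t' j - (s + t) j = (Pi.single i (∑ i, t' i - ∑ i, t i) : Fin 3 → F) j := by
        simp only [s, Pi.add_apply, Pi.sub_apply]; ring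
      rw [this]
      by_cases hj : j = i
      · subst hj; simpa [← hi] using h2
      · simp [hj]
    refine ⟨borelG s 1, borelG_one_mem_N0 hs, _, mul_mem h3 hk, ?_⟩
    rw [borelG_one_mul]; group

/-- The diagonal torus element with entries powers of the uniformizer. -/
def powers (u : Fˣ) (n : Fin 3 → ℤ) : Fin 3 → Fˣ := fun i => u ^ n i

theorem IsNormalizedUniformizer.exists_iwasawaG {ϖ : F} (h : IsNormalizedUniformizer ϖ) (g : G F) :
    ∃ (t : Fin 3 → F) (n : Fin 3 → ℤ), ∃ k ∈ integralG F,
      g = borelG t (powers (Units.mk0 ϖ h.ne_zero) n) * k := by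
  choose t n k hk hg using fun i => h.exists_iwasawa (g i)
  exact ⟨t, n, k, mem_integralG.mpr hk, funext hg⟩

end Cell

section Weil

theorem quadForm_smul {F : Type*} [Field F] {n : ℕ} (J : Matrix (Fin n) (Fin n) F) (a : F)
    (v : Fin n → F) : quadForm J (a • v) = a ^ 2 * quadForm J v := by
  simp only [quadForm, innerJ, mulVec_smul, dotProduct_smul, smul_dotProduct, smul_eq_mul]
  ring

/-- The integral points of an affine space. -/
def integralVectors (F : Type*) [NontriviallyNormedField F] [IsUltrametricDist F] (n : ℕ) :
    Set (Fin n → F) := {x | ∀ k, x k ∈ 𝒪[F]}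

theorem indicator_VO {F : Type*} [NontriviallyNormedField F] [IsUltrametricDist F]
    {d : Fin 3 → ℕ} (v : V F d) :
    (VO F d).indicator (1 : V F d → ℂ) v =
    ∏ i, (integralVectors F (d i)).indicator (1 : (Fin (d i) → F) → ℂ) (v i) := by
  classical
  simp only [Set.indicator_apply, Pi.one_apply]
  by_cases h : v ∈ VO F d
  · rw [if_pos h, Finset.prod_eq_one]
    exact fun i _ => if_pos (h i)
  · rw [if_neg h]
    obtain ⟨i, hi⟩ : ∃ i, v i ∉ integralVectors F (d i) := by
      by_contra! hcon
      exact h fun i => hcon i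
    exact (Finset.prod_eq_zero (Finset.mem_univ i) (if_neg hi)).symm

variable {F : Type*} [NontriviallyNormedField F] [MeasurableSpace F] {n : ℕ}

theorem weilSL_borel_mul (ψ : AddChar F Circle) {J : Matrix (Fin n) (Fin n) F}
    (hJ : ∀ a b : F, a ≠ 0 → b ≠ 0 → chi J (a * b) = chi J a * chi J b)
    (dt : Measure (Fin n → F)) (t : F) (a : Fˣ) (k : SpecialLinearGroup (Fin 2) F)
    (f : (Fin n → F) → ℂ) (v : Fin n → F) :
    weilSL ψ J dt (borel t a * k) f v =
      (ψ (t * quadForm J v) : ℂ) * ((chi J a : ℂ) * ((‖(a : F)‖ ^ ((n : ℝ) / 2) : ℝ) : ℂ)) *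
        weilSL ψ J dt k f ((a : F) • v) := by
  have hdet : k 0 0 * k 1 1 - k 0 1 * k 1 0 = 1 := by rw [← det_fin_two]; exact k.2
  have ha := a.ne_zero
  have hb := borel_mul_apply t a k
  have hnorm : ∀ x : F, ‖(a : F) * x‖ ^ ((n : ℝ) / 2) =
      ‖(a : F)‖ ^ ((n : ℝ) / 2) * ‖x‖ ^ ((n : ℝ) / 2) := fun x => by
    rw [norm_mul, Real.mul_rpow (norm_nonneg _) (norm_nonneg _)]
  by_cases hc : k 1 0 = 0
  · have h00 : k 0 0 ≠ 0 := fun h0 => by simp [hc, h0] at hdet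
    rw [weilSL, if_pos (by rw [(hb 0).2, hc, mul_zero]), weilSL, if_pos hc, (hb 0).1, (hb 1).1, hc,
      mul_zero, add_zero]
    simp only [weilN, weilM, hJ _ _ ha h00, hnorm, quadForm_smul, smul_smul]
    have e : (a : F) * k 0 0 * (a * k 0 1 + t * (a : F)⁻¹ * k 1 1) * quadForm J v =
        t * quadForm J v + k 0 0 * k 0 1 * ((a : F) ^ 2 * quadForm J v) := by
      have h1 : k 0 0 * k 1 1 = 1 := by rw [hc] at hdet; linear_combination hdet
      field_simp
      linear_combination t * quadForm J v * h1
    rw [e, AddChar.map_add_eq_mul, mul_comm (k 0 0) (a : F)]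
    push_cast
    ring
  · have h1 : -((a : F)⁻¹ * k 1 0)⁻¹ = a * -(k 1 0)⁻¹ := by rw [mul_inv, inv_inv]; ring
    have h2 : (a : F)⁻¹ * k 1 1 / ((a : F)⁻¹ * k 1 0) = k 1 1 / k 1 0 := by field_simp
    have h3 : -(k 1 0)⁻¹ ≠ 0 := neg_ne_zero.mpr (inv_ne_zero hc)
    have h4 : (borel t a * k) 1 0 ≠ 0 := by
      rw [(hb 0).2]; exact mul_ne_zero (inv_ne_zero ha) hc
    rw [weilSL, if_neg h4, weilSL, if_neg hc, (hb 0).1, (hb 0).2, (hb 1).2, h1, h2]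
    simp only [weilN, weilM, hJ _ _ ha h3, hnorm, quadForm_smul, smul_smul]
    have e : ((a : F) * k 0 0 + t * (a : F)⁻¹ * k 1 0) / ((a : F)⁻¹ * k 1 0) * quadForm J v =
        t * quadForm J v + k 0 0 / k 1 0 * ((a : F) ^ 2 * quadForm J v) := by
      field_simp
      ring
    rw [e, AddChar.map_add_eq_mul, mul_comm (a : F) (-(k 1 0)⁻¹)]
    push_cast
    ring

theorem weilSL_const_mul (ψ : AddChar F Circle) (J : Matrix (Fin n) (Fin n) F)
    (dt : Measure (Fin n → F)) (g : SpecialLinearGroup (Fin 2) F) (c : ℂ)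
    (f : (Fin n → F) → ℂ) (v : Fin n → F) :
    weilSL ψ J dt g (fun t => c * f t) v = c * weilSL ψ J dt g f v := by
  unfold weilSL
  split_ifs
  · simp only [weilN, weilM]; ring
  · simp only [weilN, weilM, weilW]
    rw [show ∀ w, (∫ t, (ψ (g 1 1 / g 1 0 * quadForm J t) : ℂ) * (c * f t) *
        (ψ (innerJ J w t) : ℂ) ∂dt) = c * ∫ t, (ψ (g 1 1 / g 1 0 * quadForm J t) : ℂ) * f t *
        (ψ (innerJ J w t) : ℂ) ∂dt from fun w => by
      rw [← integral_const_mul]; congr 1; ext t; ring]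
    ring

theorem weilSL_one (ψ : AddChar F Circle) (J : Matrix (Fin n) (Fin n) F)
    (dt : Measure (Fin n → F)) (f : (Fin n → F) → ℂ) : weilSL ψ J dt 1 f = f := by
  funext v
  simp [weilSL, weilN, weilM, chi_one]

variable [IsUltrametricDist F]

theorem weilRep_indicator_VO {d : Fin 3 → ℕ} (ψ : AddChar F Circle)
    (J : (i : Fin 3) → Matrix (Fin (d i)) (Fin (d i)) F)
    (dt : (i : Fin 3) → Measure (Fin (d i) → F)) (g : G F) (v : V F d) :
    weilRep ψ J dt g ((VO F d).indicator 1) v =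
      ∏ i, weilSL ψ (J i) (dt i) (g i) ((integralVectors F (d i)).indicator 1) (v i) := by
  have step : ∀ (i : Fin 3) (c : V F d → ℂ) (f : V F d → ℂ),
      (∀ v, f v = c v * (integralVectors F (d i)).indicator 1 (v i)) →
      (∀ v t, c (Function.update v i t) = c v) → ∀ v, weilAt ψ J dt i (g i) f v =
        c v * weilSL ψ (J i) (dt i) (g i) ((integralVectors F (d i)).indicator 1) (v i) := by
    intro i c f hf hc v
    rw [weilAt, ← weilSL_const_mul]
    simp only [hf, hc, Function.update_self]
  simp only [weilRep, Fin.prod_univ_three]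
  rw [step 0 (fun v => weilSL ψ (J 1) (dt 1) (g 1) ((integralVectors F (d 1)).indicator 1) (v 1) *
    weilSL ψ (J 2) (dt 2) (g 2) ((integralVectors F (d 2)).indicator 1) (v 2)) _ (fun v => ?_)
    (fun v t => by simp)]
  · ring
  rw [step 1 (fun v => (integralVectors F (d 0)).indicator 1 (v 0) *
    weilSL ψ (J 2) (dt 2) (g 2) ((integralVectors F (d 2)).indicator 1) (v 2)) _ (fun v => ?_)
    (fun v t => by simp)]
  · ring
  rw [step 2 (fun v => (integralVectors F (d 0)).indicator 1 (v 0) *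
    (integralVectors F (d 1)).indicator 1 (v 1)) _ (fun v => ?_) (fun v t => by simp)]
  · ring
  rw [indicator_VO, Fin.prod_univ_three]

theorem weilSL_indicator_integralVectors {d : Fin 3 → ℕ} {ψ : AddChar F Circle}
    {J : (i : Fin 3) → Matrix (Fin (d i)) (Fin (d i)) F}
    {dt : (i : Fin 3) → Measure (Fin (d i) → F)}
    (hρ : ∀ k ∈ GO F, weilRep ψ J dt k ((VO F d).indicator 1) = (VO F d).indicator 1)
    (i : Fin 3) {k : SpecialLinearGroup (Fin 2) F} (hk : ∀ r s, ‖k r s‖ ≤ 1) :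
    weilSL ψ (J i) (dt i) k ((integralVectors F (d i)).indicator 1) =
      (integralVectors F (d i)).indicator 1 := by
  funext x
  have hmem : (Function.update 1 i k : G F) ∈ GO F := by
    refine mem_integralG.mpr fun j r s => ?_
    by_cases hj : j = i
    · subst hj; simpa using hk r s
    · rw [Function.update_of_ne hj]
      exact mem_integralG.mp (one_mem (integralG F)) j r s
  have h1 := congrFun (hρ _ hmem) (Function.update 0 i x)
  have h0 : ∀ j, (integralVectors F (d j)).indicator (1 : (Fin (d j) → F) → ℂ) 0 = 1 := fun j =>
    Set.indicator_of_mem (s := integralVectors F (d j)) (fun _ => zero_mem 𝒪[F]) 1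
  rw [weilRep_indicator_VO, indicator_VO, Finset.prod_eq_single i, Finset.prod_eq_single i] at h1
  · simpa using h1
  · intro j _ hj; simp [hj, h0]
  · simp
  · intro j _ hj
    rw [Function.update_of_ne hj, Function.update_of_ne hj]
    exact (congrFun (weilSL_one _ _ _ _) _).trans (h0 j)
  · simp

theorem norm_quadForm_le {d : Fin 3 → ℕ} {ψ : AddChar F Circle} (hψ : IsUnramifiedChar ψ)
    {J : (i : Fin 3) → Matrix (Fin (d i)) (Fin (d i)) F}
    {dt : (i : Fin 3) → Measure (Fin (d i) → F)}
    (hρ : ∀ k ∈ GO F, weilRep ψ J dt k ((VO F d).indicator 1) = (VO F d).indicator 1)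
    (i : Fin 3) {x : Fin (d i) → F} (hx : x ∈ integralVectors F (d i)) :
    ‖quadForm (J i) x‖ ≤ 1 := by
  refine Valued.integer.mem_iff.mp ((hψ.conductor _).mp fun y hy => ?_)
  have hint : ∀ r s, ‖(borel y 1) r s‖ ≤ 1 := by
    intro r s
    fin_cases r <;> fin_cases s <;> simp [Valued.integer.mem_iff.mp hy]
  have h1 := congrFun (weilSL_indicator_integralVectors hρ i hint) x
  rw [Set.indicator_of_mem hx] at h1
  simp [weilSL, weilN, weilM, chi_one, Set.indicator_of_mem hx] at h1
  rw [mul_comm]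
  exact Circle.coe_eq_one.mp h1

end Weil

section SymplecticBlocks

variable {F : Type*} [Field F]

theorem fromBlocks_mem_symplecticGroup {A B C D : Matrix (Fin 3) (Fin 3) F} :
    fromBlocks A B C D ∈ symplecticGroup (Fin 3) F ↔
      B * Aᵀ = A * Bᵀ ∧ A * Dᵀ - B * Cᵀ = 1 ∧ D * Aᵀ - C * Bᵀ = 1 ∧ D * Cᵀ = C * Dᵀ := by
  rw [SymplecticGroup.mem_iff, Matrix.J, fromBlocks_transpose, fromBlocks_multiply,
    fromBlocks_multiply, fromBlocks_inj]
  simp only [Matrix.mul_zero, Matrix.mul_one, Matrix.mul_neg, zero_add, add_zero, Matrix.neg_mul,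
    ← sub_eq_add_neg, sub_eq_zero]
  have h1 : ∀ X Y : Matrix (Fin 3) (Fin 3) F, X - Y = -1 ↔ Y - X = 1 := fun X Y => by
    rw [← neg_sub, neg_inj]
  rw [h1]

theorem coe_eq_fromBlocks (g : symplecticGroup (Fin 3) F) :
    (g : Matrix (Fin 3 ⊕ Fin 3) (Fin 3 ⊕ Fin 3) F) = fromBlocks (g.1.toBlocks₁₁) (g.1.toBlocks₁₂)
      (g.1.toBlocks₂₁) (g.1.toBlocks₂₂) := (fromBlocks_toBlocks _).symm

theorem embedG_mul (g g' : G F) : embedG (g * g') = embedG g * embedG g' := by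
  refine Subtype.ext ?_
  have hmul : ∀ i r s, (g * g') i r s = g i r 0 * g' i 0 s + g i r 1 * g' i 1 s := fun i r s => by
    change ((g i * g' i : SpecialLinearGroup (Fin 2) F) : Matrix (Fin 2) (Fin 2) F) r s = _
    rw [Matrix.SpecialLinearGroup.coe_mul, Matrix.mul_apply, Fin.sum_univ_two]
  simp only [embedG, hmul, Submonoid.coe_mul, fromBlocks_multiply, diagonal_mul_diagonal,
    diagonal_add]

/-- A matrix `(U 0; 0 V)` with `V = ᵗU⁻¹` as a symplectic matrix. -/
def leviSp (U V : Matrix (Fin 3) (Fin 3) F) (h : U * Vᵀ = 1) : symplecticGroup (Fin 3) F :=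
  ⟨fromBlocks U 0 0 V, fromBlocks_mem_symplecticGroup.mpr
    ⟨by simp, by simpa using h, by simpa using congrArg transpose h, by simp⟩⟩

end SymplecticBlocks

section DoubleCoset

variable {F : Type*} [NontriviallyNormedField F] [IsUltrametricDist F]

theorem norm_det_le_one {n : ℕ} {A : Matrix (Fin n) (Fin n) F} (hA : ∀ r s, ‖A r s‖ ≤ 1) :
    ‖A.det‖ ≤ 1 := by
  rw [← Valued.integer.mem_iff, det_apply]
  refine sum_mem fun σ _ => ?_
  rw [Units.smul_def]
  exact zsmul_mem (prod_mem fun i _ => Valued.integer.mem_iff.mpr (hA _ _)) _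

theorem mem_SpO_iff {k : symplecticGroup (Fin 3) F} :
    k ∈ SpO F ↔ ∀ r s, ‖(k : Matrix (Fin 3 ⊕ Fin 3) (Fin 3 ⊕ Fin 3) F) r s‖ ≤ 1 := by
  show (∀ r s, _ ∈ 𝒪[F]) ↔ _
  simp only [Valued.integer.mem_iff]

theorem SpO_mul_mem {k k' : symplecticGroup (Fin 3) F} (hk : k ∈ SpO F) (hk' : k' ∈ SpO F) :
    k * k' ∈ SpO F := by
  intro r s
  rw [Submonoid.coe_mul, Matrix.mul_apply]
  exact sum_mem fun l _ => mul_mem (hk r l) (hk' l s)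

theorem SpO_inv_mem {k : symplecticGroup (Fin 3) F} (hk : k ∈ SpO F) : k⁻¹ ∈ SpO F := by
  have hJ : ∀ r s, Matrix.J (Fin 3) F r s ∈ 𝒪[F] := by
    rintro (r | r) (s | s)
    · simp [Matrix.J]
    · simp only [Matrix.J, fromBlocks_apply₁₂, Matrix.neg_apply, Matrix.one_apply]
      split_ifs
      exacts [neg_mem (one_mem _), neg_mem (zero_mem _)]
    · simp only [Matrix.J, fromBlocks_apply₂₁, Matrix.one_apply]
      split_ifs
      exacts [one_mem _, zero_mem _]
    · simp [Matrix.J]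
  intro r s
  rw [SymplecticGroup.coe_inv, Matrix.mul_apply]
  refine sum_mem fun l _ => mul_mem ?_ (hJ l s)
  rw [Matrix.mul_apply]
  refine sum_mem fun m _ => mul_mem ?_ (hk l m)
  exact neg_mem (hJ r m)

theorem mul_mem_doubleCoset_iff {ϖ : F} {c : ℤ} {g k : symplecticGroup (Fin 3) F}
    (hk : k ∈ SpO F) : g * k ∈ doubleCoset ϖ c ↔ g ∈ doubleCoset ϖ c := by
  have key : ∀ (g k : symplecticGroup (Fin 3) F), k ∈ SpO F → g ∈ doubleCoset ϖ c →
      g * k ∈ doubleCoset ϖ c := by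
    rintro g k hk ⟨h, hh, k', hk', hg⟩
    exact ⟨h, hh, k' * k, SpO_mul_mem hk' hk, by
      rw [Submonoid.coe_mul, hg, Submonoid.coe_mul, Matrix.mul_assoc]⟩
  refine ⟨fun h => ?_, key g k hk⟩
  simpa using key _ _ (SpO_inv_mem hk) h

theorem mem_doubleCoset_iff_of_toBlocks₂₁_eq_zero {ϖ : F} (hϖ : ϖ ≠ 0) {c : ℤ}
    {g : symplecticGroup (Fin 3) F} (hC : g.1.toBlocks₂₁ = 0) :
    g ∈ doubleCoset ϖ c ↔ ‖g.1.toBlocks₂₂.det‖ = ‖ϖ‖ ^ c := by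
  have hE : ∀ x : F, (diagonal ![x, 1, 1] : Matrix (Fin 3) (Fin 3) F).det = x := fun x => by
    simp [det_diagonal, Fin.prod_univ_three]
  have hEE : ∀ x : F, x ≠ 0 → (diagonal ![x, 1, 1] : Matrix (Fin 3) (Fin 3) F) *
      diagonal ![x⁻¹, 1, 1] = 1 := fun x hx => by
    rw [diagonal_mul_diagonal, ← diagonal_one]
    congr 1
    ext i; fin_cases i <;> simp [hx]
  constructor
  · rintro ⟨_, ⟨A, Z, hA, hZ, rfl⟩, k, hk, hg⟩
    have hkb := coe_eq_fromBlocks k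
    set a := k.1.toBlocks₁₁
    set b := k.1.toBlocks₁₂
    set c' := k.1.toBlocks₂₁ with hc'
    set d := k.1.toBlocks₂₂
    rw [hkb, cochar, fromBlocks_multiply, fromBlocks_multiply, fromBlocks_multiply] at hg
    simp only [Matrix.mul_zero, Matrix.zero_mul, Matrix.mul_one, add_zero, zero_add] at hg
    have hDdet : ((A⁻¹)ᵀ * diagonal ![ϖ ^ c, 1, 1]).det = ϖ ^ c := by
      rw [det_mul, hE, det_transpose, det_nonsing_inv, hA]; simp
    have h21 : (A⁻¹)ᵀ * diagonal ![ϖ ^ c, 1, 1] * c' = 0 := by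
      rw [← hC, hg]; rfl
    have h22 : g.1.toBlocks₂₂ = (A⁻¹)ᵀ * diagonal ![ϖ ^ c, 1, 1] * d := by
      rw [hg]; rfl
    have hc0 : c' = 0 := by
      have hu : IsUnit ((A⁻¹)ᵀ * diagonal ![ϖ ^ c, 1, 1]).det := by
        rw [hDdet]; exact (zpow_ne_zero c hϖ).isUnit
      have := congrArg (((A⁻¹)ᵀ * diagonal ![ϖ ^ c, 1, 1])⁻¹ * ·) h21
      simpa [← Matrix.mul_assoc, nonsing_inv_mul _ hu] using this
    have hmem := k.2
    rw [hkb, fromBlocks_mem_symplecticGroup] at hmem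
    have had : a.det * d.det = 1 := by
      have := congrArg det hmem.2.1
      simpa [hc0] using this
    have ha : ‖a.det‖ ≤ 1 := norm_det_le_one fun r s => mem_SpO_iff.mp hk (Sum.inl r) (Sum.inl s)
    have hd : ‖d.det‖ ≤ 1 := norm_det_le_one fun r s => mem_SpO_iff.mp hk (Sum.inr r) (Sum.inr s)
    have h1 : ‖a.det‖ * ‖d.det‖ = 1 := by rw [← norm_mul, had, norm_one]
    have hd1 : ‖d.det‖ = 1 := by nlinarith [norm_nonneg a.det, norm_nonneg d.det]
    rw [h22, det_mul, hDdet, norm_mul, hd1, mul_one, norm_zpow]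
  · intro hdet
    have hgb := coe_eq_fromBlocks g
    set A := g.1.toBlocks₁₁
    set B := g.1.toBlocks₁₂
    set D := g.1.toBlocks₂₂
    rw [hC] at hgb
    have hmem := g.2
    have hmemT := SymplecticGroup.transpose_mem g.2
    rw [hgb, fromBlocks_mem_symplecticGroup] at hmem
    rw [hgb, fromBlocks_transpose, fromBlocks_mem_symplecticGroup] at hmemT
    have hAD : A * Dᵀ = 1 := by simpa using hmem.2.1
    have hBD : Dᵀ * B = Bᵀ * D := by simpa using hmemT.2.2.2
    have hdAD : A.det * D.det = 1 := by simpa using congrArg det hAD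
    set δ := D.det with hδ
    have hδ0 : δ ≠ 0 := right_ne_zero_of_mul_eq_one hdAD
    have hw : ϖ ^ c ≠ 0 := zpow_ne_zero c hϖ
    set u := δ / ϖ ^ c with hu
    have hu0 : u ≠ 0 := div_ne_zero hδ0 hw
    have hu1 : ‖u‖ = 1 := by
      rw [hu, norm_div, hdet, norm_zpow, div_self (zpow_ne_zero c (norm_ne_zero_iff.mpr hϖ))]
    have hET : ∀ x : F, (diagonal ![x, 1, 1] : Matrix (Fin 3) (Fin 3) F)ᵀ = diagonal ![x, 1, 1] :=
      fun x => diagonal_transpose _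
    let A' := A * diagonal ![δ, 1, 1]
    have hA'D' : A' * (D * diagonal ![δ⁻¹, 1, 1])ᵀ = 1 := by
      rw [transpose_mul, hET, Matrix.mul_assoc, ← Matrix.mul_assoc (diagonal _) (diagonal _),
        hEE δ hδ0, Matrix.one_mul, hAD]
    have hA'inv : A'⁻¹ = (D * diagonal ![δ⁻¹, 1, 1])ᵀ := inv_eq_right_inv hA'D'
    let k : symplecticGroup (Fin 3) F := leviSp (diagonal ![u⁻¹, 1, 1]) (diagonal ![u, 1, 1]) (by
      rw [hET]; simpa using hEE u⁻¹ (inv_ne_zero hu0))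
    refine ⟨_, ⟨A', A'⁻¹ * (B * diagonal ![δ⁻¹, 1, 1]), ?_, ?_, rfl⟩, k, ?_, ?_⟩
    · rw [det_mul, hE, hdAD]
    · rw [hA'inv, transpose_mul, transpose_mul, transpose_transpose, transpose_mul, hET]
      simp only [Matrix.mul_assoc]
      rw [← Matrix.mul_assoc Dᵀ, hBD, Matrix.mul_assoc]
    · rw [mem_SpO_iff]
      have hdi : ∀ x : F, ‖x‖ ≤ 1 → ∀ r s,
          ‖(diagonal ![x, 1, 1] : Matrix (Fin 3) (Fin 3) F) r s‖ ≤ 1 := by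
        intro x hx r s
        fin_cases r <;> fin_cases s <;> simp [diagonal, hx]
      rintro (r | r) (s | s)
      · exact hdi _ (by rw [norm_inv, hu1, inv_one]) r s
      · simp [k, leviSp]
      · simp [k, leviSp]
      · exact hdi _ hu1.le r s
    · have e1 : (diagonal ![ϖ ^ (-c), 1, 1] : Matrix (Fin 3) (Fin 3) F) * diagonal ![u⁻¹, 1, 1] =
          diagonal ![δ⁻¹, 1, 1] := by
        rw [diagonal_mul_diagonal]
        congr 1
        ext i; fin_cases i <;> simp [hu]
        field_simp
      have e2 : (diagonal ![ϖ ^ c, 1, 1] : Matrix (Fin 3) (Fin 3) F) * diagonal ![u, 1, 1] =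
          diagonal ![δ, 1, 1] := by
        rw [diagonal_mul_diagonal]
        congr 1
        ext i; fin_cases i <;> simp [hu]
        field_simp
      have e3 : (diagonal ![δ⁻¹, 1, 1] : Matrix (Fin 3) (Fin 3) F) * diagonal ![δ, 1, 1] = 1 := by
        simpa using hEE δ⁻¹ (inv_ne_zero hδ0)
      rw [Matrix.mul_assoc, hgb]
      simp only [k, leviSp, cochar, fromBlocks_multiply, Matrix.mul_zero, Matrix.zero_mul,
        Matrix.mul_one, add_zero, zero_add, e1, e2]
      have hdA' : IsUnit A'.det := by
        rw [det_mul, hE, hdAD]; exact isUnit_one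
      rw [← Matrix.mul_assoc A' A'⁻¹, mul_nonsing_inv _ hdA', Matrix.one_mul, Matrix.mul_assoc B,
        e3, Matrix.mul_one, hA'inv, transpose_transpose, Matrix.mul_assoc D, e3, Matrix.mul_one,
        Matrix.mul_assoc A, hEE δ hδ0, Matrix.mul_one]

end DoubleCoset

section OpenOrbit

/-- A matrix of determinant one with integral entries whose right action kills the first entry
of a row vector. -/
theorem exists_integral_row_reduction {F : Type*} [NontriviallyNormedField F] (α δ : F)
    (hα : α ≠ 0) :
    ∃ κ : SpecialLinearGroup (Fin 2) F, (∀ r s, ‖κ r s‖ ≤ 1) ∧ α * κ 0 0 + δ * κ 1 0 = 0 ∧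
      ‖α * κ 0 1 + δ * κ 1 1‖ = max ‖α‖ ‖δ‖ := by
  rcases le_total ‖δ‖ ‖α‖ with h | h
  · refine ⟨⟨!![-δ / α, -1; 1, 0], by simp [det_fin_two]⟩, ?_, ?_, ?_⟩
    · have : ‖δ‖ / ‖α‖ ≤ 1 := div_le_one_of_le₀ h (norm_nonneg _)
      intro r s
      fin_cases r <;> fin_cases s <;> simp [this]
    · simp; field_simp; ring
    · simp [h]
  · have hδ : δ ≠ 0 := fun h0 => hα (by simpa [h0] using h)
    refine ⟨⟨!![1, 0; -α / δ, 1], by simp [det_fin_two]⟩, ?_, ?_, ?_⟩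
    · have : ‖α‖ / ‖δ‖ ≤ 1 := div_le_one_of_le₀ h (norm_nonneg _)
      intro r s
      fin_cases r <;> fin_cases s <;> simp [this]
    · simp; field_simp; ring
    · simp [h]

theorem gamma0_mul_embedG_borelG {F : Type*} [Field F] (t : Fin 3 → F) (a : Fin 3 → Fˣ) :
    (gamma0 F * embedG (borelG t a)).1.toBlocks₂₁ = vecMulVec ![1, 0, 0] (fun i => (a i : F)) ∧
      (gamma0 F * embedG (borelG t a)).1.toBlocks₂₂ =
        !![t 0 * (a 0 : F)⁻¹, t 1 * (a 1 : F)⁻¹, t 2 * (a 2 : F)⁻¹;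
          -(a 0 : F)⁻¹, (a 1 : F)⁻¹, 0; -(a 0 : F)⁻¹, 0, (a 2 : F)⁻¹] := by
  rw [Submonoid.coe_mul]
  simp only [gamma0, embedG, fromBlocks_multiply, toBlocks_fromBlocks₂₁, toBlocks_fromBlocks₂₂]
  constructor <;>
  · ext r s
    fin_cases r <;> fin_cases s <;>
      simp [borelG, vecMulVec, vecMul_diagonal]

variable {F : Type*} [NontriviallyNormedField F] [IsUltrametricDist F]

theorem embedG_mem_SpO {k : G F} (hk : k ∈ integralG F) : embedG k ∈ SpO F := by
  have hd : ∀ x : Fin 3 → F, (∀ i, x i ∈ 𝒪[F]) → ∀ r s, diagonal x r s ∈ 𝒪[F] := by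
    intro x hx r s
    rw [diagonal_apply]
    split_ifs
    exacts [hx r, zero_mem _]
  rintro (r | r) (s | s) <;> exact hd _ (fun i => hk i _ _) r s

theorem exists_mul_toBlocks₂₁_eq_zero (t : Fin 3 → F) (a : Fin 3 → Fˣ) :
    ∃ k ∈ SpO F, (gamma0 F * embedG (borelG t a) * k).1.toBlocks₂₁ = 0 ∧
      ‖(gamma0 F * embedG (borelG t a) * k).1.toBlocks₂₂.det‖ =
        max ‖∑ i, t i‖ (radius a) / ∏ i, ‖(a i : F)‖ := by
  obtain ⟨i, hi, hmax⟩ := exists_radius_eq a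
  have ha : ∀ j, (a j : F) ≠ 0 := fun j => (a j).ne_zero
  have hai : 0 < ‖(a i : F)‖ := norm_pos_iff.mpr (ha i)
  let w : Fin 3 → F := fun j => if j = i then 0 else a j / a i
  have hwi : w i = 0 := if_pos rfl
  have hw : ∀ j, ‖w j‖ ≤ 1 := fun j => by
    by_cases hj : j = i
    · simp [w, hj]
    · simp only [w, if_neg hj, norm_div]
      exact div_le_one_of_le₀ (hmax j) (norm_nonneg _)
  let e : Fin 3 → F := Pi.single i 1
  have he : ∀ j, ‖e j‖ ≤ 1 := fun j => by
    by_cases hj : j = i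
    · subst hj; simp [e]
    · simp [e, hj]
  have hwe : w ⬝ᵥ e = 0 := by simp [e, hwi]
  let U : Matrix (Fin 3) (Fin 3) F := 1 - vecMulVec e w
  let V' : Matrix (Fin 3) (Fin 3) F := 1 + vecMulVec w e
  have hUV : U * V'ᵀ = 1 := by
    simp only [U, V', transpose_add, transpose_one, transpose_vecMulVec, Matrix.mul_add,
      Matrix.mul_one, Matrix.sub_mul, Matrix.one_mul, vecMulVec_mul_vecMulVec, hwe, zero_smul]
    simp
  have hone : ∀ r s : Fin 3, ‖(1 : Matrix (Fin 3) (Fin 3) F) r s‖ ≤ 1 := fun r s => by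
    rw [one_apply]; split_ifs <;> simp
  have hk1 : leviSp U V' hUV ∈ SpO F := by
    have hprod : ∀ x y : F, ‖x‖ ≤ 1 → ‖y‖ ≤ 1 → ‖x * y‖ ≤ 1 := fun x y hx hy => by
      rw [norm_mul]; exact mul_le_one₀ hx (norm_nonneg _) hy
    rw [mem_SpO_iff]
    rintro (r | r) (s | s)
    · exact (norm_sub_le_max_norm _ _).trans (max_le (hone r s) (hprod _ _ (he r) (hw s)))
    · simp [leviSp]
    · simp [leviSp]
    · exact (IsUltrametricDist.norm_add_le_max _ _).trans
        (max_le (hone r s) (hprod _ _ (hw r) (he s)))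
  obtain ⟨κ, hκ, hκ0, hκ1⟩ := exists_integral_row_reduction (a i : F) ((∑ j, t j) / a i) (ha i)
  let k₂ : G F := Function.update 1 i κ
  have hk2 : k₂ ∈ integralG F := by
    refine mem_integralG.mpr fun j r s => ?_
    by_cases hj : j = i
    · subst hj; simpa [k₂] using hκ r s
    · simp only [k₂, Function.update_of_ne hj]
      exact mem_integralG.mp (one_mem (integralG F)) j r s
  refine ⟨leviSp U V' hUV * embedG k₂, SpO_mul_mem hk1 (embedG_mem_SpO hk2), ?_⟩
  obtain ⟨hC, hD⟩ := gamma0_mul_embedG_borelG t a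
  set C : Matrix (Fin 3) (Fin 3) F := vecMulVec ![1, 0, 0] (fun i => (a i : F)) 
  set D : Matrix (Fin 3) (Fin 3) F := !![t 0 * (a 0 : F)⁻¹, t 1 * (a 1 : F)⁻¹, t 2 * (a 2 : F)⁻¹;
          -(a 0 : F)⁻¹, (a 1 : F)⁻¹, 0; -(a 0 : F)⁻¹, 0, (a 2 : F)⁻¹]
  obtain ⟨A, B, hgb⟩ : ∃ A B, (gamma0 F * embedG (borelG t a)).1 = fromBlocks A B C D :=
    ⟨_, _, by rw [← hC, ← hD]; exact coe_eq_fromBlocks _⟩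
  have hCU : ∀ r s, (C * U) r s = if s = i then (![1, 0, 0] : Fin 3 → F) r * a i else 0 := by
    intro r s
    simp only [U, C, Matrix.mul_sub, vecMulVec_mul_vecMulVec, Matrix.sub_apply,
      vecMulVec_apply, e, dotProduct_single, mul_one, Pi.smul_apply, smul_eq_mul, w]
    split_ifs with hs
    · simp [hs]
    · field_simp [ha i]; ring
  have hDw : ∀ r, D r i + (D *ᵥ w) r = (![1, 0, 0] : Fin 3 → F) r * ((∑ j, t j) / a i) := by
    intro r
    have hsum : ∑ j, D r j * a j = (![1, 0, 0] : Fin 3 → F) r * ∑ j, t j := by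
      fin_cases r <;> simp [D, Fin.sum_univ_three, ha]
    have h1 : (D *ᵥ w) r = ∑ j, D r j * (a j / a i) - D r i := by
      simp only [Matrix.mulVec, dotProduct, w]
      rw [← Finset.add_sum_erase _ _ (Finset.mem_univ i),
        ← Finset.add_sum_erase (a := i) _ (fun j => D r j * (a j / a i)) (Finset.mem_univ i)]
      rw [if_pos rfl, div_self (ha i), mul_zero, mul_one, zero_add, add_sub_cancel_left]
      refine Finset.sum_congr rfl fun j hj => ?_
      rw [if_neg (Finset.ne_of_mem_erase hj)]
    rw [h1, add_sub_cancel, ← mul_div_assoc, ← hsum, Finset.sum_div]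
    exact Finset.sum_congr rfl fun j _ => (mul_div_assoc _ _ _).symm
  have hDV : ∀ r s, (D * V') r s = if s = i then
      (![1, 0, 0] : Fin 3 → F) r * ((∑ j, t j) / a i) else D r s := by
    intro r s
    simp only [V', Matrix.mul_add, Matrix.mul_one, mul_vecMulVec, Matrix.add_apply,
      vecMulVec_apply, e]
    split_ifs with hs
    · rw [hs, Pi.single_eq_same, mul_one, hDw]
    · rw [Pi.single_eq_of_ne hs, mul_zero, add_zero]
  have hk₂i : k₂ i = κ := Function.update_self _ _ _
  have hk₂j : ∀ j, j ≠ i → k₂ j = 1 := fun j hj => Function.update_of_ne hj _ _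
  have hk : (leviSp U V' hUV * embedG k₂).1 =
      fromBlocks (U * diagonal fun j => k₂ j 0 0) (U * diagonal fun j => k₂ j 0 1)
        (V' * diagonal fun j => k₂ j 1 0) (V' * diagonal fun j => k₂ j 1 1) := by
    rw [Submonoid.coe_mul]
    simp only [leviSp, embedG, fromBlocks_multiply, Matrix.zero_mul, add_zero, zero_add]
  rw [Submonoid.coe_mul, hgb, hk, fromBlocks_multiply, toBlocks_fromBlocks₂₁,
    toBlocks_fromBlocks₂₂]
  simp only [← Matrix.mul_assoc]
  refine ⟨?_, ?_⟩
  · ext r s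
    rw [Matrix.add_apply, mul_diagonal, mul_diagonal, hCU, hDV]
    by_cases hs : s = i
    · subst hs
      rw [if_pos rfl, if_pos rfl, hk₂i]
      simp only [Matrix.zero_apply]
      linear_combination (![1, 0, 0] : Fin 3 → F) r * hκ0
    · rw [if_neg hs, if_neg hs, hk₂j s hs]
      simp
  · set β := (a i : F) * κ 0 1 + (∑ j, t j) / a i * κ 1 1 with hβ
    have hD'' : C * U * diagonal (fun j => k₂ j 0 1) + D * V' * diagonal (fun j => k₂ j 1 1) =
        of fun r s => if s = i then (![1, 0, 0] : Fin 3 → F) r * β else D r s := by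
      ext r s
      rw [Matrix.add_apply, mul_diagonal, mul_diagonal, hCU, hDV, of_apply]
      by_cases hs : s = i
      · subst hs
        rw [if_pos rfl, if_pos rfl, if_pos rfl, hk₂i, hβ]
        ring
      · rw [if_neg hs, if_neg hs, if_neg hs, hk₂j s hs]
        simp
    have hβn : ‖β‖ = max ‖∑ j, t j‖ (radius a) / ‖(a i : F)‖ := by
      rw [hκ1, max_comm, norm_div, hi, ← max_div_div_right hai.le]
      congr 1
      field_simp
    rw [hD'']
    have hnz : ∀ j, ‖(a j : F)‖ ≠ 0 := fun j => norm_ne_zero_iff.mpr (ha j)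
    have hdet : ‖(of fun r s => if s = i then (![1, 0, 0] : Fin 3 → F) r * β else D r s).det‖ =
        ‖β‖ * ‖(a i : F)‖ / ∏ j, ‖(a j : F)‖ := by
      rw [eq_div_iff (Finset.prod_ne_zero_iff.mpr fun j _ => hnz j), det_fin_three,
        Fin.prod_univ_three]
      have h0 := hnz 0
      have h1 := hnz 1
      have h2 := hnz 2
      clear_value β
      clear hκ1 hβ hD'' hβn
      fin_cases i <;> simp [D] <;> field_simp
    rw [hdet, hβn]
    field_simp

theorem gamma0_mul_mem_doubleCoset_iff {ϖ : F} (hϖ : ϖ ≠ 0) {c : ℤ} (t : Fin 3 → F)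
    (a : Fin 3 → Fˣ) {k : G F} (hk : k ∈ integralG F) :
    gamma0 F * embedG (borelG t a * k) ∈ doubleCoset ϖ c ↔
      max ‖∑ i, t i‖ (radius a) / ∏ i, ‖(a i : F)‖ = ‖ϖ‖ ^ c := by
  obtain ⟨k', hk', h1, h2⟩ := exists_mul_toBlocks₂₁_eq_zero t a
  rw [embedG_mul, ← mul_assoc, mul_mem_doubleCoset_iff (embedG_mem_SpO hk),
    ← mul_mem_doubleCoset_iff hk', mem_doubleCoset_iff_of_toBlocks₂₁_eq_zero hϖ h1, h2]

open Classical in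
theorem hasSum_basicFun {ϖ : F} {g : symplecticGroup (Fin 3) F}
    {m : ℤ} (hg : ∀ c, g ∈ doubleCoset ϖ c ↔ m = c) :
    HasSum (fun j : ℕ => if 2 * (j : ℤ) ≤ m then (Nat.card 𝓀[F] : ℂ) ^ (2 * j) else 0)
      (basicFun ϖ g) := by
  have hterm : ∀ j : ℕ, ∑' k : ℕ, (Nat.card 𝓀[F] : ℂ) ^ (2 * j) *
      (doubleCoset ϖ ((k : ℤ) + 2 * (j : ℤ))).indicator 1 g =
      if 2 * (j : ℤ) ≤ m then (Nat.card 𝓀[F] : ℂ) ^ (2 * j) else 0 := by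
    intro j
    rw [tsum_eq_single (m - 2 * j).toNat]
    · simp only [Set.indicator_apply, hg, Pi.one_apply]
      by_cases hj : 2 * (j : ℤ) ≤ m
      · rw [if_pos hj, if_pos (by omega), mul_one]
      · rw [if_neg hj, if_neg (by omega), mul_zero]
    · intro k hk
      simp only [Set.indicator_apply, hg, Pi.one_apply]
      rw [if_neg (by omega), mul_zero]
  rw [basicFun]
  simp only [hterm]
  refine (summable_of_ne_finset_zero (s := Finset.range (m.toNat + 1)) fun j hj => ?_).hasSum
  rw [Finset.mem_range] at hj
  exact if_neg (by omega)

end OpenOrbit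

section Topology

variable {F : Type*} [NontriviallyNormedField F]

instance [SecondCountableTopology F] :
    SecondCountableTopology (SpecialLinearGroup (Fin 2) F) :=
  have : SecondCountableTopology (Matrix (Fin 2) (Fin 2) F) :=
    inferInstanceAs (SecondCountableTopology (Fin 2 → Fin 2 → F))
  (Topology.IsEmbedding.subtypeVal (X := Matrix (Fin 2) (Fin 2) F)).secondCountableTopology

theorem continuous_entry (i : Fin 3) (r s : Fin 2) : Continuous fun g : G F => g i r s := by
  have h1 : Continuous fun g : SpecialLinearGroup (Fin 2) F =>
      (g : Matrix (Fin 2) (Fin 2) F) r s :=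
    (continuous_subtype_val (p := fun A : Matrix (Fin 2) (Fin 2) F => A.det = 1)).matrix_elem r s
  exact h1.comp (continuous_apply i)

variable [IsUltrametricDist F]

theorem isOpen_integralG : IsOpen (integralG F : Set (G F)) := by
  have : (integralG F : Set (G F)) = ⋂ i, ⋂ r, ⋂ s, {g : G F | ‖g i r s‖ ≤ 1} := by
    ext g
    simp only [SetLike.mem_coe, mem_integralG, Set.mem_iInter, Set.mem_ofPred_eq]
  rw [this]
  refine isOpen_iInter_of_finite fun i => isOpen_iInter_of_finite fun r =>
    isOpen_iInter_of_finite fun s => ?_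
  have h1 := (IsUltrametricDist.isOpen_closedBall (0 : F) one_ne_zero).preimage
    (continuous_entry i r s)
  simpa [Set.preimage, Metric.closedBall] using h1

theorem isCompact_integralG [ProperSpace F] : IsCompact (integralG F : Set (G F)) := by
  have hM : IsCompact {A : Matrix (Fin 2) (Fin 2) F | ∀ r s, ‖A r s‖ ≤ 1} := by
    have h1 : IsCompact (Set.univ.pi fun _ : Fin 2 => Set.univ.pi fun _ : Fin 2 =>
        Metric.closedBall (0 : F) 1) :=
      isCompact_univ_pi fun _ => isCompact_univ_pi fun _ => isCompact_closedBall _ _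
    have h2 : {A : Matrix (Fin 2) (Fin 2) F | ∀ r s, ‖A r s‖ ≤ 1} =
        Set.univ.pi fun _ : Fin 2 => Set.univ.pi fun _ : Fin 2 => Metric.closedBall (0 : F) 1 :=
      Set.ext fun A => by
        change _ ↔ ∀ r, _ → ∀ s, _ → A r s ∈ Metric.closedBall (0 : F) 1
        simp
    rw [h2]; exact h1
  have hcl : IsClosed {A : Matrix (Fin 2) (Fin 2) F | A.det = 1} :=
    isClosed_eq (continuous_id.matrix_det) continuous_const
  have hS : IsCompact {k : SpecialLinearGroup (Fin 2) F | ∀ r s, ‖k r s‖ ≤ 1} :=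
    hcl.isClosedEmbedding_subtypeVal.isCompact_preimage hM
  convert isCompact_univ_pi fun _ : Fin 3 => hS using 1
  ext g
  simp [mem_integralG, Set.mem_pi]

theorem isOpen_cell (g : G F) : IsOpen (cell g) := by
  have : cell g = ⋃ n ∈ N0 F, (fun x => (n * g)⁻¹ * x) ⁻¹' (integralG F : Set (G F)) := by
    ext x
    simp only [cell, Set.mem_ofPred_eq, Set.mem_iUnion, exists_prop, Set.mem_preimage,
      SetLike.mem_coe]
    refine exists_congr fun n => and_congr_right fun _ => ⟨?_, fun h => ⟨_, h, by group⟩⟩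
    rintro ⟨k, hk, rfl⟩
    simpa [mul_assoc] using hk
  rw [this]
  exact isOpen_biUnion fun n _ => isOpen_integralG.preimage (continuous_const_mul _)

end Topology

section N0

variable {F : Type*} [Field F]

theorem N0_mul_apply (m n : N0 F) (l : Fin 3) :
    ((m * n : N0 F) : G F) l 0 1 = (m : G F) l 0 1 + (n : G F) l 0 1 := by
  obtain ⟨s, -, hs⟩ := mem_N0_iff.mp m.2
  obtain ⟨t, -, ht⟩ := mem_N0_iff.mp n.2
  rw [Subgroup.coe_mul, hs, ht, borelG_one_mul]
  simp [borelG]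

theorem N0_inv_apply (m : N0 F) (l : Fin 3) :
    ((m⁻¹ : N0 F) : G F) l 0 1 = -(m : G F) l 0 1 := by
  have h1 : ((1 : N0 F) : G F) l 0 1 = 0 := by
    change ((1 : SpecialLinearGroup (Fin 2) F) : Matrix (Fin 2) (Fin 2) F) 0 1 = 0
    simp
  have := N0_mul_apply m⁻¹ m l
  rw [inv_mul_cancel, h1] at this
  exact eq_neg_of_add_eq_zero_left this.symm

theorem N0_sum_apply (n : N0 F) : ∑ l, (n : G F) l 0 1 = 0 := by
  obtain ⟨t, ht, h⟩ := mem_N0_iff.mp n.2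
  rw [h]
  simpa [borelG] using ht

theorem N0_mul_comm (m n : N0 F) : m * n = n * m := by
  obtain ⟨s, -, hs⟩ := mem_N0_iff.mp m.2
  obtain ⟨t, -, ht⟩ := mem_N0_iff.mp n.2
  refine Subtype.ext ?_
  rw [Subgroup.coe_mul, Subgroup.coe_mul, hs, ht, borelG_one_mul, borelG_one_mul, add_comm]

theorem exists_N0_apply {i j : Fin 3} (hij : i ≠ j) (x : F) :
    ∃ n : N0 F, (n : G F) j 0 1 = x ∧ ∀ l, l ≠ i → l ≠ j → (n : G F) l 0 1 = 0 := by
  refine ⟨⟨borelG (Pi.single j x - Pi.single i x) 1, borelG_one_mem_N0 (by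
    simp [Finset.sum_sub_distrib])⟩, ?_, fun l hli hlj => ?_⟩
  · simp [borelG, hij.symm]
  · simp [borelG, hli, hlj]

end N0

section Volume

variable {F : Type*} [NontriviallyNormedField F] [IsUltrametricDist F]
  [SecondCountableTopology F] [MeasurableSpace (SpecialLinearGroup (Fin 2) F)]
  [BorelSpace (SpecialLinearGroup (Fin 2) F)]

theorem measurableSet_N0_box (j k : Fin 3) (r r' : ℝ) :
    MeasurableSet {n : N0 F | ‖(n : G F) j 0 1‖ ≤ r ∧ ‖(n : G F) k 0 1‖ ≤ r'} := by
  have h : ∀ j, Continuous fun n : N0 F => ‖(n : G F) j 0 1‖ := fun j =>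
    ((continuous_entry j 0 1).comp continuous_subtype_val).norm
  exact ((isClosed_le (h j) continuous_const).inter
    (isClosed_le (h k) continuous_const)).measurableSet

theorem measure_N0_box_step {ϖ : F} (h : IsNormalizedUniformizer ϖ) (dn : Measure (N0 F))
    [dn.IsMulLeftInvariant] {i j k : Fin 3} (hij : i ≠ j) (hik : i ≠ k) (hjk : j ≠ k) (r : ℝ)
    (x : ℤ) :
    dn {n | ‖(n : G F) j 0 1‖ ≤ ‖ϖ‖ ^ x ∧ ‖(n : G F) k 0 1‖ ≤ r} =
      Nat.card 𝓀[F] * dn {n | ‖(n : G F) j 0 1‖ ≤ ‖ϖ‖ ^ (x + 1) ∧ ‖(n : G F) k 0 1‖ ≤ r} := by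
  obtain ⟨u, hu⟩ := h.exists_residue_representatives x
  have := h.finite_residueField
  choose e he1 he2 using fun c => exists_N0_apply hij (u c)
  have hcoord : ∀ c (n : N0 F), ((e c)⁻¹ * n ∈
      {n : N0 F | ‖(n : G F) j 0 1‖ ≤ ‖ϖ‖ ^ (x + 1) ∧ ‖(n : G F) k 0 1‖ ≤ r}) ↔
      ‖-u c + (n : G F) j 0 1‖ ≤ ‖ϖ‖ ^ (x + 1) ∧ ‖(n : G F) k 0 1‖ ≤ r := fun c n => by
    rw [Set.mem_ofPred_eq, N0_mul_apply, N0_mul_apply, N0_inv_apply, N0_inv_apply, he1,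
      he2 c k hik.symm hjk.symm, neg_zero, zero_add]
  refine measure_eq_card_mul_of_existsUnique dn (measurableSet_N0_box j k _ r) e fun n => ?_
  simp only [hcoord]
  refine ⟨fun hn => ?_, fun c hc => ⟨(hu _).2 c hc.1, hc.2⟩⟩
  obtain ⟨c, hc, hcu⟩ := (hu _).1 hn.1
  exact ⟨c, ⟨hc, hn.2⟩, fun c' hc' => hcu c' hc'.1⟩

theorem measure_N0_box {ϖ : F} (h : IsNormalizedUniformizer ϖ) (dn : Measure (N0 F))
    [dn.IsMulLeftInvariant] (hdn : dn {n | (n : G F) ∈ GO F} = 1) (a : Fin 3 → Fˣ) :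
    dn {n | ∀ l, ‖(n : G F) l 0 1‖ ≤ ‖(a l : F)‖ ^ 2} =
      ENNReal.ofReal ((∏ l, ‖(a l : F)‖) ^ 2 / radius a) := by
  obtain ⟨i, hi, hmax⟩ := exists_radius_eq a
  obtain ⟨j, k, hij, hik, hjk, huniv⟩ : ∃ j k, i ≠ j ∧ i ≠ k ∧ j ≠ k ∧
      ∀ f : Fin 3 → Prop, (∀ l, f l) ↔ f i ∧ f j ∧ f k := by
    have h3 : ∀ f : Fin 3 → Prop, (∀ l, f l) ↔ f 0 ∧ f 1 ∧ f 2 := fun f =>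
      ⟨fun hf => ⟨hf 0, hf 1, hf 2⟩, fun ⟨_, _, _⟩ l => by fin_cases l <;> assumption⟩
    fin_cases i
    · exact ⟨1, 2, by decide, by decide, by decide, h3⟩
    · exact ⟨0, 2, by decide, by decide, by decide, fun f => (h3 f).trans and_left_comm⟩
    · exact ⟨0, 1, by decide, by decide, by decide, fun f => (h3 f).trans
        (by rw [← and_assoc, and_comm]; exact Iff.rfl)⟩
  have hset : (Finset.univ : Finset (Fin 3)) = {i, j, k} := by
    ext l
    simpa using (huniv fun l => l = i ∨ l = j ∨ l = k).mpr (by tauto) l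
  have hprod : ∏ l, ‖(a l : F)‖ = ‖(a i : F)‖ * (‖(a j : F)‖ * ‖(a k : F)‖) := by
    rw [hset, Finset.prod_insert (by simp [hij, hik]), Finset.prod_pair hjk]
  have hbox : ∀ b : Fin 3 → ℝ, b j ≤ b i → b k ≤ b i →
      {n : N0 F | ∀ l, ‖(n : G F) l 0 1‖ ≤ b l} =
        {n : N0 F | ‖(n : G F) j 0 1‖ ≤ b j ∧ ‖(n : G F) k 0 1‖ ≤ b k} := by
    intro b hbj hbk
    ext n
    rw [Set.mem_ofPred_eq, Set.mem_ofPred_eq, huniv]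
    refine ⟨And.right, fun hn => ⟨?_, hn⟩⟩
    have hsum : (n : G F) i 0 1 = -((n : G F) j 0 1 + (n : G F) k 0 1) := by
      have h1 := N0_sum_apply n
      rw [hset, Finset.sum_insert (by simp [hij, hik]), Finset.sum_pair hjk] at h1
      exact eq_neg_of_add_eq_zero_left h1
    rw [hsum, norm_neg]
    exact (IsUltrametricDist.norm_add_le_max _ _).trans
      (max_le (hn.1.trans hbj) (hn.2.trans hbk))
  obtain ⟨x, hx⟩ := h.exists_zpow (a j).ne_zero
  obtain ⟨y, hy⟩ := h.exists_zpow (a k).ne_zero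
  have h1 : {n : N0 F | (n : G F) ∈ GO F} =
      {n : N0 F | ‖(n : G F) j 0 1‖ ≤ ‖ϖ‖ ^ (0 : ℤ) ∧ ‖(n : G F) k 0 1‖ ≤ ‖ϖ‖ ^ (0 : ℤ)} := by
    rw [zpow_zero, ← hbox (fun _ => 1) le_rfl le_rfl]
    ext n
    change (n : G F) ∈ integralG F ↔ _
    obtain ⟨t, -, ht⟩ := mem_N0_iff.mp n.2
    rw [mem_integralG, Set.mem_ofPred_eq, ht]
    refine forall_congr' fun l => ⟨fun h => h 0 1, fun h r s => ?_⟩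
    fin_cases r <;> fin_cases s <;> simp_all [borelG]
  have hpow : ∀ z : ℤ, (‖ϖ‖ ^ z) ^ 2 = ‖ϖ‖ ^ (2 * z) := fun z => by
    rw [mul_comm, _root_.zpow_mul, zpow_ofNat]
  have hsq : ∀ l, ‖(a l : F)‖ ^ 2 ≤ ‖(a i : F)‖ ^ 2 := fun l =>
    pow_le_pow_left₀ (norm_nonneg _) (hmax l) 2
  rw [hbox (fun l => ‖(a l : F)‖ ^ 2) (hsq j) (hsq k), hx, hy, hpow, hpow,
    h.eq_zpow_mul_of_step (f := fun x => dn {n | ‖(n : G F) j 0 1‖ ≤ ‖ϖ‖ ^ x ∧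
      ‖(n : G F) k 0 1‖ ≤ ‖ϖ‖ ^ (2 * y)}) (measure_N0_box_step h dn hij hik hjk _)]
  simp only [and_comm (a := ‖(_ : F)‖ ≤ ‖ϖ‖ ^ (0 : ℤ))]
  rw [h.eq_zpow_mul_of_step (f := fun y => dn {n | ‖(n : G F) k 0 1‖ ≤ ‖ϖ‖ ^ y ∧
      ‖(n : G F) j 0 1‖ ≤ ‖ϖ‖ ^ (0 : ℤ)}) (measure_N0_box_step h dn hik hij hjk.symm _)]
  simp only [and_comm (a := ‖((_ : G F) k 0 1 : F)‖ ≤ ‖ϖ‖ ^ (0 : ℤ))]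
  rw [← h1, hdn, mul_one, ← ENNReal.ofReal_mul (by positivity), hi, hprod, hx, hy]
  congr 1
  have : ‖(a i : F)‖ ≠ 0 := norm_ne_zero_iff.mpr (a i).ne_zero
  rw [← hpow, ← hpow]
  field_simp

end Volume

section QuotientVolume

variable {F : Type*} [NontriviallyNormedField F] [IsUltrametricDist F]

/-- The image of the double coset `N₀(F) g SL₂(𝒪)³` in `N₀(F) \ G(F)`. -/
def quotientCell (g : G F) : Set (N0Quot F) := {x | x.out ∈ cell g}

theorem mul_mem_cell_iff {n g x : G F} (hn : n ∈ N0 F) : n * x ∈ cell g ↔ x ∈ cell g := by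
  constructor
  · rintro ⟨m, hm, k, hk, h⟩
    exact ⟨n⁻¹ * m, mul_mem (inv_mem hn) hm, k, hk, by
      rw [mul_assoc, mul_assoc, ← mul_assoc m, ← h, inv_mul_cancel_left]⟩
  · rintro ⟨m, hm, k, hk, rfl⟩
    exact ⟨n * m, mul_mem hn hm, k, hk, by simp only [mul_assoc]⟩

theorem mk_mem_quotientCell_iff {g x : G F} :
    (Quotient.mk'' x : N0Quot F) ∈ quotientCell g ↔ x ∈ cell g := by
  have h1 : x * ((Quotient.mk'' x : N0Quot F).out)⁻¹ ∈ N0 F :=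
    QuotientGroup.rightRel_apply.mp (Quotient.mk_out (s := QuotientGroup.rightRel (N0 F)) x)
  rw [quotientCell, Set.mem_ofPred_eq, ← mul_mem_cell_iff h1, inv_mul_cancel_right]

variable [MeasurableSpace (SpecialLinearGroup (Fin 2) F)]
  [BorelSpace (SpecialLinearGroup (Fin 2) F)]

theorem measurableSet_quotientCell [SecondCountableTopology F] (g : G F) :
    MeasurableSet (quotientCell g) := by
  refine measurableSet_quotient.mpr ?_
  have : (Quotient.mk'' : G F → N0Quot F) ⁻¹' quotientCell g = cell g :=
    Set.ext fun x => mk_mem_quotientCell_iff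
  rw [this]
  exact (isOpen_cell g).measurableSet

theorem measureReal_quotientCell [ProperSpace F] {ϖ : F} (h : IsNormalizedUniformizer ϖ)
    {dg : Measure (G F)} (hdg : dg.IsHaarMeasure) (hdg1 : dg (GO F) = 1)
    {dn : Measure (N0 F)} (hdn : dn.IsHaarMeasure) (hdn1 : dn {n | (n : G F) ∈ GO F} = 1)
    {dx : Measure (N0Quot F)} (hdx : IsQuotientMeasure dg dn dx) (t : Fin 3 → F)
    (a : Fin 3 → Fˣ) :
    dx.real (quotientCell (borelG t a)) = radius a / (∏ i, ‖(a i : F)‖) ^ 2 := by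
  set g := borelG t a with hg
  let S : Set (G F) := (fun x => g⁻¹ * x) ⁻¹' (integralG F : Set (G F))
  have hcont : Continuous fun x : G F => g⁻¹ * x := continuous_const_mul _
  have hSo : IsOpen S := isOpen_integralG.preimage hcont
  have hSc : IsCompact S :=
    (Homeomorph.mulLeft g⁻¹).isCompact_preimage.mpr isCompact_integralG
  have hclopen : IsClopen S := ⟨hSc.isClosed, hSo⟩
  have hf := hdx (S.indicator 1) ((IsClopen.continuous_indicator hclopen) continuous_one)
    (HasCompactSupport.of_support_subset_isCompact hSc Set.support_indicator_subset)
  have hlhs : ∫ x, S.indicator (1 : G F → ℝ) x ∂dg = 1 := by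
    rw [integral_indicator_one hSo.measurableSet, Measure.real, measure_preimage_mul]
    change (dg (GO F)).toReal = 1
    rw [hdg1, ENNReal.toReal_one]
  have hrad : 0 < radius a := by
    obtain ⟨i, hi, -⟩ := exists_radius_eq a
    rw [hi]
    have := norm_pos_iff.mpr (a i).ne_zero
    positivity
  have hprod : 0 < ∏ i, ‖(a i : F)‖ := Finset.prod_pos fun i _ => norm_pos_iff.mpr (a i).ne_zero
  have hinner : ∀ x : N0Quot F, ∫ n : N0 F, S.indicator (1 : G F → ℝ) ((n : G F) * x.out) ∂dn =
      (quotientCell g).indicator (fun _ => (∏ i, ‖(a i : F)‖) ^ 2 / radius a) x := by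
    intro x
    have hmeas : MeasurableSet {n : N0 F | (n : G F) * x.out ∈ S} :=
      (hSo.preimage (continuous_subtype_val.mul continuous_const)).measurableSet
    have h1 : (fun n : N0 F => S.indicator (1 : G F → ℝ) ((n : G F) * x.out)) =
        {n : N0 F | (n : G F) * x.out ∈ S}.indicator 1 := rfl
    rw [h1, integral_indicator_one hmeas]
    by_cases hx : x ∈ quotientCell g
    · rw [Set.indicator_of_mem hx]
      obtain ⟨m, hm, k, hk, hxk⟩ := hx
      have h2 : {n : N0 F | (n : G F) * x.out ∈ S} = (fun n => ⟨m, hm⟩ * n) ⁻¹'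
          {n : N0 F | ∀ l, ‖(n : G F) l 0 1‖ ≤ ‖(a l : F)‖ ^ 2} := by
        ext n
        rw [Set.mem_preimage, N0_mul_comm]
        obtain ⟨s, -, hs⟩ := mem_N0_iff.mp (n * ⟨m, hm⟩ : N0 F).2
        have h3 : g⁻¹ * ((n : G F) * x.out) = g⁻¹ * borelG (s + t) a * k := by
          rw [← borelG_one_mul, ← hs, hxk, ← hg]
          simp only [Subgroup.coe_mul, mul_assoc]
        change g⁻¹ * ((n : G F) * x.out) ∈ integralG F ↔ _
        rw [h3, (integralG F).mul_mem_cancel_right hk, hg, borelG_mem_iff, Set.mem_ofPred_eq, hs]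
        simp [borelG]
      rw [h2, Measure.real, measure_preimage_mul, measure_N0_box h dn hdn1,
        ENNReal.toReal_ofReal (by positivity)]
    · rw [Set.indicator_of_notMem hx]
      have h2 : {n : N0 F | (n : G F) * x.out ∈ S} = ∅ := by
        rw [Set.eq_empty_iff_forall_notMem]
        refine fun n hn => hx ?_
        exact ⟨(n : G F)⁻¹, inv_mem n.2, _, hn, by group⟩
      rw [h2, measureReal_empty]
  simp only [hinner] at hf
  rw [hlhs, integral_indicator_const _ (measurableSet_quotientCell g), smul_eq_mul] at hf
  field_simp at hf ⊢
  linarith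

end QuotientVolume

section Factors

variable {F : Type*} [NontriviallyNormedField F]

/-- `|a₁a₂a₃|`. -/
def normProd (a : Fin 3 → Fˣ) : ℝ := ∏ i, ‖(a i : F)‖

theorem norm_unit_pos (x : Fˣ) : 0 < ‖(x : F)‖ := norm_pos_iff.mpr x.ne_zero

theorem normProd_pos (a : Fin 3 → Fˣ) : 0 < normProd a :=
  Finset.prod_pos fun i _ => norm_unit_pos (a i)

theorem normProd_congr {a b : Fin 3 → Fˣ} (h : ∀ i, ‖(a i : F)‖ = ‖(b i : F)‖) :
    normProd a = normProd b := Finset.prod_congr rfl fun i _ => h i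

theorem radius_le_iff {a : Fin 3 → Fˣ} {r : ℝ} : radius a ≤ r ↔ ∀ i, ‖(a i : F)‖ ^ 2 ≤ r := by
  refine ⟨fun h i => (norm_sq_le_radius a i).trans h, fun h => ?_⟩
  obtain ⟨i, hi, -⟩ := exists_radius_eq a
  exact hi ▸ h i

theorem radius_congr {a b : Fin 3 → Fˣ} (h : ∀ i, ‖(a i : F)‖ = ‖(b i : F)‖) :
    radius a = radius b :=
  le_antisymm (radius_le_iff.mpr fun i => h i ▸ norm_sq_le_radius b i)
    (radius_le_iff.mpr fun i => h i ▸ norm_sq_le_radius a i)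

theorem one_le_norm_of_radius_le {a : Fin 3 → Fˣ} (h : radius a ≤ normProd a) (i : Fin 3) :
    1 ≤ ‖(a i : F)‖ := by
  have h' := radius_le_iff.mp h
  simp only [normProd, Fin.prod_univ_three] at h'
  have key : ∀ x y z : ℝ, 0 < x → 0 < y → 0 < z → y ^ 2 ≤ x * y * z → z ^ 2 ≤ x * y * z →
      1 ≤ x := by
    intro x y z hx hy hz h1 h2
    have h3 : y ≤ x * z := le_of_mul_le_mul_right (by linarith) hy
    have h4 : z ≤ x * y := le_of_mul_le_mul_right (by linarith) hz
    by_contra! hlt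
    nlinarith [mul_lt_mul_of_pos_right hlt hz, mul_lt_mul_of_pos_right hlt hy]
  have p0 := norm_unit_pos (a 0)
  have p1 := norm_unit_pos (a 1)
  have p2 := norm_unit_pos (a 2)
  fin_cases i
  · exact key _ _ _ p0 p1 p2 (h' 1) (h' 2)
  · refine key _ ‖(a 0 : F)‖ ‖(a 2 : F)‖ p1 p0 p2 ((h' 0).trans_eq ?_) ((h' 2).trans_eq ?_) <;>
      exact congrArg (· * _) (mul_comm _ _)
  · refine key _ ‖(a 0 : F)‖ ‖(a 1 : F)‖ p2 p0 p1 ((h' 0).trans_eq ?_) ((h' 1).trans_eq ?_) <;>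
      exact (mul_comm _ _).trans (mul_assoc _ _ _).symm

theorem norm_le_mul_of_radius_le {a : Fin 3 → Fˣ} (h : radius a ≤ normProd a) {i j l : Fin 3}
    (hij : i ≠ j) (hli : l ≠ i) (hlj : l ≠ j) : ‖(a l : F)‖ ≤ ‖(a i : F)‖ * ‖(a j : F)‖ := by
  have hset : (Finset.univ : Finset (Fin 3)) = {l, i, j} := by
    revert i j l; decide
  have h' := radius_le_iff.mp h l
  rw [normProd, hset, Finset.prod_insert (by simp [hli, hlj]), Finset.prod_pair hij, pow_two] at h'
  exact le_of_mul_le_mul_left h' (norm_unit_pos _)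

theorem IsNormalizedUniformizer.exists_max_eq_zpow [IsUltrametricDist F] {ϖ : F}
    (h : IsNormalizedUniformizer ϖ) (s : F)
    (a : Fin 3 → Fˣ) : ∃ m : ℤ, max ‖s‖ (radius a) / normProd a = ‖ϖ‖ ^ m := by
  have hr : ∃ x : F, x ≠ 0 ∧ ‖x‖ = max ‖s‖ (radius a) := by
    obtain ⟨i, hi, -⟩ := exists_radius_eq a
    rcases le_total ‖s‖ (radius a) with hle | hle
    · exact ⟨(a i : F) ^ 2, pow_ne_zero 2 (a i).ne_zero, by rw [norm_pow, max_eq_right hle, hi]⟩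
    · refine ⟨s, fun hs => ?_, (max_eq_left hle).symm⟩
      rw [hs, norm_zero, hi] at hle
      have := norm_unit_pos (a i)
      nlinarith
  obtain ⟨x, hx, hxe⟩ := hr
  obtain ⟨m, hm⟩ := h.exists_zpow (x := x / ∏ i, (a i : F))
    (div_ne_zero hx (Finset.prod_ne_zero_iff.mpr fun i _ => (a i).ne_zero))
  exact ⟨m, by rw [← hm, norm_div, hxe, norm_prod, normProd]⟩

variable [IsUltrametricDist F] {d : Fin 3 → ℕ}

/-- The value at `v` of the torus element `a` applied to the characteristic function of `V(𝒪)`. -/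
noncomputable def weilFactor (J : (i : Fin 3) → Matrix (Fin (d i)) (Fin (d i)) F) (v : V F d)
    (a : Fin 3 → Fˣ) : ℂ :=
  ∏ i, (((chi (J i) (a i : F) : ℂ) * ((‖(a i : F)‖ ^ ((d i : ℝ) / 2) : ℝ) : ℂ)) *
    (integralVectors F (d i)).indicator 1 ((a i : F) • v i))

theorem smul_mem_integralVectors_iff {n : ℕ} {a : F} {v : Fin n → F} :
    a • v ∈ integralVectors F n ↔ ∀ k, ‖a‖ * ‖v k‖ ≤ 1 := by
  simp only [integralVectors, Set.mem_ofPred_eq, Pi.smul_apply, smul_eq_mul,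
    Valued.integer.mem_iff, norm_mul]

theorem indicator_integralVectors_congr {n : ℕ} {a b : F} (h : ‖a‖ = ‖b‖) (v : Fin n → F) :
    (integralVectors F n).indicator (1 : (Fin n → F) → ℂ) (a • v) =
      (integralVectors F n).indicator 1 (b • v) := by
  have : a • v ∈ integralVectors F n ↔ b • v ∈ integralVectors F n := by
    rw [smul_mem_integralVectors_iff, smul_mem_integralVectors_iff, h]
  classical
  simp only [Set.indicator_apply, this, Pi.one_apply]

variable {J : (i : Fin 3) → Matrix (Fin (d i)) (Fin (d i)) F} {v : V F d}

theorem weilFactor_congr (hJ : ∀ i, ∀ u : F, ‖u‖ = 1 → chi (J i) u = 1) {a b : Fin 3 → Fˣ}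
    (h : ∀ i, ‖(a i : F)‖ = ‖(b i : F)‖) : weilFactor J v a = weilFactor J v b :=
  Finset.prod_congr rfl fun i _ => by
    rw [chi_eq_of_norm_eq (hJ i) (b i).ne_zero (h i), h i, indicator_integralVectors_congr (h i)]

theorem smul_mem_of_weilFactor_ne_zero {a : Fin 3 → Fˣ} (h : weilFactor J v a ≠ 0) (i : Fin 3) :
    (a i : F) • v i ∈ integralVectors F (d i) := by
  by_contra hi
  refine h (Finset.prod_eq_zero (Finset.mem_univ i) ?_)
  rw [Set.indicator_of_notMem hi, mul_zero]

theorem finite_setOf_weilFactor_ne_zero {ϖ : F} (h : IsNormalizedUniformizer ϖ) (hv : v ∈ Ysm J) :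
    {n : Fin 3 → ℤ | radius (powers (Units.mk0 ϖ h.ne_zero) n) ≤
      normProd (powers (Units.mk0 ϖ h.ne_zero) n) ∧
      weilFactor J v (powers (Units.mk0 ϖ h.ne_zero) n) ≠ 0}.Finite := by
  obtain ⟨-, i, j, hij, hvi, hvj⟩ := hv
  obtain ⟨ki, hki⟩ := Function.ne_iff.mp hvi
  obtain ⟨kj, hkj⟩ := Function.ne_iff.mp hvj
  have hBi : 0 < ‖v i ki‖ := norm_pos_iff.mpr hki
  have hBj : 0 < ‖v j kj‖ := norm_pos_iff.mpr hkj
  obtain ⟨N, hN⟩ := pow_unbounded_of_one_lt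
    (‖v i ki‖⁻¹ + ‖v j kj‖⁻¹ + ‖v i ki‖⁻¹ * ‖v j kj‖⁻¹) ((one_lt_inv₀ h.norm_pos).mpr h.norm_lt_one)
  refine (Set.finite_Icc (fun _ => -(N : ℤ)) (0 : Fin 3 → ℤ)).subset ?_
  rintro n ⟨h1, h2⟩
  have hnorm : ∀ l, ‖((powers (Units.mk0 ϖ h.ne_zero) n l : Fˣ) : F)‖ = ‖ϖ‖ ^ n l := fun l => by
    simp [powers]
  have hai : ‖((powers (Units.mk0 ϖ h.ne_zero) n i : Fˣ) : F)‖ ≤ ‖v i ki‖⁻¹ := by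
    rw [← one_div, le_div_iff₀ hBi]
    exact smul_mem_integralVectors_iff.mp (smul_mem_of_weilFactor_ne_zero h2 i) ki
  have haj : ‖((powers (Units.mk0 ϖ h.ne_zero) n j : Fˣ) : F)‖ ≤ ‖v j kj‖⁻¹ := by
    rw [← one_div, le_div_iff₀ hBj]
    exact smul_mem_integralVectors_iff.mp (smul_mem_of_weilFactor_ne_zero h2 j) kj
  have hIi := inv_pos.mpr hBi
  have hIj := inv_pos.mpr hBj
  have hbound : ∀ l, ‖ϖ‖ ^ n l ≤ ‖ϖ‖ ^ (-(N : ℤ)) := fun l => by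
    rw [_root_.zpow_neg, zpow_natCast, ← inv_pow, ← hnorm l]
    refine le_trans ?_ hN.le
    by_cases hli : l = i
    · rw [hli]; nlinarith
    by_cases hlj : l = j
    · rw [hlj]; nlinarith
    refine (norm_le_mul_of_radius_le h1 hij hli hlj).trans ?_
    have := mul_le_mul hai haj (norm_nonneg _) hIi.le
    linarith
  refine ⟨fun l => h.zpow_le_zpow_iff.mp (hbound l), fun l => ?_⟩
  have h3 := one_le_norm_of_radius_le h1 l
  rw [hnorm, ← zpow_zero ‖ϖ‖, h.zpow_le_zpow_iff] at h3
  exact h3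

end Factors

section Orbital

variable {F : Type*} [NontriviallyNormedField F] [IsUltrametricDist F]

theorem hasSum_basicFun_gamma0 {ϖ : F} (h : IsNormalizedUniformizer ϖ) (t : Fin 3 → F)
    (a : Fin 3 → Fˣ) {k : G F} (hk : k ∈ integralG F) :
    HasSum (fun j : ℕ => if max ‖∑ i, t i‖ (radius a) ≤ ‖ϖ‖ ^ (2 * j) * normProd a then
      (Nat.card 𝓀[F] : ℂ) ^ (2 * j) else 0)
      (basicFun ϖ (gamma0 F * embedG (borelG t a * k))) := by
  obtain ⟨m, hm⟩ := h.exists_max_eq_zpow (∑ i, t i) a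
  convert hasSum_basicFun (ϖ := ϖ) (m := m) (fun c => ?_) using 2 with j
  · have h1 : ‖ϖ‖ ^ (2 * j) = ‖ϖ‖ ^ (2 * (j : ℤ)) := by
      exact_mod_cast (zpow_natCast ‖ϖ‖ (2 * j)).symm
    have h2 : max ‖∑ i, t i‖ (radius a) ≤ ‖ϖ‖ ^ (2 * j) * normProd a ↔ 2 * (j : ℤ) ≤ m := by
      rw [← div_le_iff₀ (normProd_pos a), hm, h1, h.zpow_le_zpow_iff]
    simp only [h2]
  · rw [gamma0_mul_mem_doubleCoset_iff h.ne_zero t a hk, ← h.zpow_inj, ← hm, normProd]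

theorem basicFun_gamma0_eq_zero {ϖ : F} (h : IsNormalizedUniformizer ϖ) {t : Fin 3 → F}
    {a : Fin 3 → Fˣ} {k : G F} (hk : k ∈ integralG F)
    (hlt : normProd a < max ‖∑ i, t i‖ (radius a)) :
    basicFun ϖ (gamma0 F * embedG (borelG t a * k)) = 0 := by
  refine (hasSum_basicFun_gamma0 h t a hk).unique ?_
  convert hasSum_zero using 2 with j
  refine if_neg (not_le.mpr (lt_of_le_of_lt ?_ hlt))
  exact mul_le_of_le_one_left (normProd_pos a).le
    (pow_le_one₀ h.norm_pos.le h.norm_lt_one.le)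

variable [MeasurableSpace F] {d : Fin 3 → ℕ} {ψ : AddChar F Circle}
  {J : (i : Fin 3) → Matrix (Fin (d i)) (Fin (d i)) F}
  {dt : (i : Fin 3) → Measure (Fin (d i) → F)}

theorem weilRep_borelG_mul {ϖ : F} (h : IsNormalizedUniformizer ϖ)
    (hJ : ∀ i, ∀ u : F, ‖u‖ = 1 → chi (J i) u = 1)
    (hρ : ∀ k ∈ GO F, weilRep ψ J dt k ((VO F d).indicator 1) = (VO F d).indicator 1)
    {v : V F d} {s : F} (hs : ∀ i, quadForm (J i) (v i) = s) (t : Fin 3 → F) (a : Fin 3 → Fˣ)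
    {k : G F} (hk : k ∈ integralG F) :
    weilRep ψ J dt (borelG t a * k) ((VO F d).indicator 1) v =
      (ψ ((∑ i, t i) * s) : ℂ) * weilFactor J v a := by
  have h1 : (ψ ((∑ i, t i) * s) : ℂ) = ∏ i, (ψ (t i * s) : ℂ) := by
    simp only [Fin.sum_univ_three, Fin.prod_univ_three, add_mul, AddChar.map_add_eq_mul,
      Circle.coe_mul]
  rw [weilRep_indicator_VO, h1, weilFactor, ← Finset.prod_mul_distrib]
  refine Finset.prod_congr rfl fun i _ => ?_
  change weilSL ψ (J i) (dt i) (borel (t i) (a i) * k i) _ _ = _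
  rw [weilSL_borel_mul ψ (fun a b ha hb => chi_mul h (hJ i) ha hb), hs,
    weilSL_indicator_integralVectors hρ i (mem_integralG.mp hk i), mul_assoc]

theorem norm_mul_radius_le_one (hψ : IsUnramifiedChar ψ)
    (hρ : ∀ k ∈ GO F, weilRep ψ J dt k ((VO F d).indicator 1) = (VO F d).indicator 1)
    {v : V F d} {s : F} (hs : ∀ i, quadForm (J i) (v i) = s) {a : Fin 3 → Fˣ}
    (ha : weilFactor J v a ≠ 0) : ‖s‖ * radius a ≤ 1 := by
  obtain ⟨i, hi, -⟩ := exists_radius_eq a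
  have := norm_quadForm_le hψ hρ i (smul_mem_of_weilFactor_ne_zero ha i)
  rw [quadForm_smul, hs, norm_mul, norm_pow] at this
  rw [hi, mul_comm]
  exact this

end Orbital

section OrbitalTerm

variable {F : Type*} [NontriviallyNormedField F] [IsUltrametricDist F] {d : Fin 3 → ℕ}

/-- The contribution of the torus element `a` to the `j`-th summand of the local integral. -/
noncomputable def orbitalTerm (ϖ : F) (J : (i : Fin 3) → Matrix (Fin (d i)) (Fin (d i)) F)
    (v : V F d) (s : F) (j : ℕ) (a : Fin 3 → Fˣ) : ℂ :=
  if radius a ≤ ‖ϖ‖ ^ (2 * j) * normProd a then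
    (if ‖s‖ * (‖ϖ‖ ^ (2 * j) * normProd a) ≤ 1 then (((normProd a)⁻¹ : ℝ) : ℂ) else 0) *
      weilFactor J v a
  else 0

theorem orbitalTerm_congr {ϖ : F} {J : (i : Fin 3) → Matrix (Fin (d i)) (Fin (d i)) F}
    {v : V F d} (hJ : ∀ i, ∀ u : F, ‖u‖ = 1 → chi (J i) u = 1) (s : F) (j : ℕ)
    {a b : Fin 3 → Fˣ} (h : ∀ i, ‖(a i : F)‖ = ‖(b i : F)‖) :
    orbitalTerm ϖ J v s j a = orbitalTerm ϖ J v s j b := by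
  simp only [orbitalTerm, radius_congr h, normProd_congr h, weilFactor_congr hJ h]

open Classical in
theorem sum_transversal_eq_orbitalTerm [ProperSpace F] {ϖ : F} (h : IsNormalizedUniformizer ϖ)
    {ψ : AddChar F Circle} (hψ : IsUnramifiedChar ψ)
    {J : (i : Fin 3) → Matrix (Fin (d i)) (Fin (d i)) F} {v : V F d} {s : F} (j : ℕ)
    {a : Fin 3 → Fˣ} (hs : ‖s‖ * radius a ≤ 1) {T : Finset F}
    (hT : IsBallTransversal (normProd a) (radius a) T) :
    ∑ t ∈ T, ((radius a / normProd a ^ 2 : ℝ) : ℂ) *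
      ((if max ‖t‖ (radius a) ≤ ‖ϖ‖ ^ (2 * j) * normProd a then (Nat.card 𝓀[F] : ℂ) ^ (2 * j)
        else 0) * ((ψ (t * s) : ℂ) * weilFactor J v a)) = orbitalTerm ϖ J v s j a := by
  have hP := normProd_pos a
  have hR : ‖ϖ‖ ^ (2 * j) * normProd a ≤ normProd a :=
    mul_le_of_le_one_left hP.le (pow_le_one₀ h.norm_pos.le h.norm_lt_one.le)
  by_cases hr : radius a ≤ ‖ϖ‖ ^ (2 * j) * normProd a
  · obtain ⟨N, hN⟩ : ∃ N : ℤ, radius a = ‖ϖ‖ ^ N := by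
      obtain ⟨i, hi, -⟩ := exists_radius_eq a
      obtain ⟨N, hN⟩ := h.exists_zpow (pow_ne_zero 2 (a i).ne_zero)
      exact ⟨N, by rw [hi, ← hN, norm_pow]⟩
    obtain ⟨M, hM⟩ : ∃ M : ℤ, ‖ϖ‖ ^ (2 * j) * normProd a = ‖ϖ‖ ^ M := by
      obtain ⟨M, hM⟩ := h.exists_zpow (x := ϖ ^ (2 * j) * ∏ i, (a i : F))
        (mul_ne_zero (pow_ne_zero _ h.ne_zero)
          (Finset.prod_ne_zero_iff.mpr fun i _ => (a i).ne_zero))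
      exact ⟨M, by rw [← hM, norm_mul, norm_pow, norm_prod, normProd]⟩
    have hT' := hT.filter hr hR
    have hMN : M ≤ N := by rwa [← h.zpow_le_zpow_iff, ← hM, ← hN]
    rw [hM, hN] at hT'
    have key := hT'.sum_addChar h hψ hMN (s := s) (by rwa [← hN])
    rw [← hM, ← hN] at key
    rw [orbitalTerm, if_pos hr]
    have hterm : ∀ t, ((radius a / normProd a ^ 2 : ℝ) : ℂ) *
        ((if max ‖t‖ (radius a) ≤ ‖ϖ‖ ^ (2 * j) * normProd a then (Nat.card 𝓀[F] : ℂ) ^ (2 * j)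
        else 0) * ((ψ (t * s) : ℂ) * weilFactor J v a)) =
        (((normProd a ^ 2)⁻¹ : ℝ) : ℂ) * (Nat.card 𝓀[F] : ℂ) ^ (2 * j) * weilFactor J v a *
          ((if ‖t‖ ≤ ‖ϖ‖ ^ (2 * j) * normProd a then (ψ (t * s) : ℂ) else 0) *
            (radius a : ℂ)) := by
      intro t
      simp only [max_le_iff, hr, and_true]
      split_ifs
      · push_cast; ring
      · simp
    rw [Finset.sum_congr rfl fun t _ => hterm t, ← Finset.mul_sum, ← Finset.sum_mul,
      ← Finset.sum_filter, key]
    split_ifs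
    · have hq : (Nat.card 𝓀[F] : ℂ) = ((‖ϖ‖⁻¹ : ℝ) : ℂ) := by
        rw [← h.card_eq]; simp
      have h1 : (normProd a ^ 2)⁻¹ * ‖ϖ‖⁻¹ ^ (2 * j) * (‖ϖ‖ ^ (2 * j) * normProd a) =
          (normProd a)⁻¹ := by
        have := h.norm_pos.ne'
        have := hP.ne'
        rw [inv_pow]
        field_simp
      rw [hq, ← h1]
      push_cast
      ring
    · simp
  · rw [orbitalTerm, if_neg hr]
    refine Finset.sum_eq_zero fun t _ => ?_
    rw [if_neg fun hmax => hr ((le_max_right _ _).trans hmax)]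
    simp

end OrbitalTerm

section LocalIntegral

theorem sum_single_zero {F : Type*} [Field F] (t : F) :
    ∑ i, (Pi.single 0 t : Fin 3 → F) i = t := by simp

theorem norm_powers {F : Type*} [NontriviallyNormedField F] {ϖ : F} (h : ϖ ≠ 0)
    (n : Fin 3 → ℤ) (i : Fin 3) : ‖((powers (Units.mk0 ϖ h) n i : Fˣ) : F)‖ = ‖ϖ‖ ^ n i := by
  simp [powers]

variable {F : Type*} [NontriviallyNormedField F] [IsUltrametricDist F] [MeasurableSpace F]
  {d : Fin 3 → ℕ} {ψ : AddChar F Circle} {J : (i : Fin 3) → Matrix (Fin (d i)) (Fin (d i)) F}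
  {dt : (i : Fin 3) → Measure (Fin (d i) → F)}

theorem integrand_eq_sum {ϖ : F} (h : IsNormalizedUniformizer ϖ) (hψ : IsUnramifiedChar ψ)
    (hJ : ∀ i, ∀ u : F, ‖u‖ = 1 → chi (J i) u = 1)
    (hρ : ∀ k ∈ GO F, weilRep ψ J dt k ((VO F d).indicator 1) = (VO F d).indicator 1)
    {v : V F d} {s : F} (hs : ∀ i, quadForm (J i) (v i) = s) {S : Finset (Fin 3 → ℤ)}
    (hS : ∀ n, n ∈ S ↔ radius (powers (Units.mk0 ϖ h.ne_zero) n) ≤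
      normProd (powers (Units.mk0 ϖ h.ne_zero) n) ∧
      weilFactor J v (powers (Units.mk0 ϖ h.ne_zero) n) ≠ 0)
    {T : (Fin 3 → ℤ) → Finset F} (hT : ∀ n ∈ S,
      IsBallTransversal (normProd (powers (Units.mk0 ϖ h.ne_zero) n))
        (radius (powers (Units.mk0 ϖ h.ne_zero) n)) (T n)) (x : N0Quot F) :
    integrand ψ J dt (basicFun ϖ) ((VO F d).indicator 1) v x = ∑ n ∈ S, ∑ t ∈ T n,
      (quotientCell (borelG (Pi.single 0 t) (powers (Units.mk0 ϖ h.ne_zero) n))).indicator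
        (fun _ => basicFun ϖ (gamma0 F *
            embedG (borelG (Pi.single 0 t) (powers (Units.mk0 ϖ h.ne_zero) n))) *
          ((ψ (t * s) : ℂ) * weilFactor J v (powers (Units.mk0 ϖ h.ne_zero) n))) x := by
  classical
  set A := powers (Units.mk0 ϖ h.ne_zero) with hA
  obtain ⟨t', n', k, hk, hx⟩ := h.exists_iwasawaG x.out
  rw [← hA] at hx
  have hmem : ∀ n t, x ∈ quotientCell (borelG (Pi.single 0 t) (A n)) ↔
      n' = n ∧ ‖∑ i, t' i - t‖ ≤ radius (A n) := by
    intro n t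
    change x.out ∈ cell _ ↔ _
    rw [hx, borelG_mul_mem_cell_iff hk, sum_single_zero]
    refine and_congr_left fun _ => ⟨fun hn => funext fun i => ?_, fun hn i => by rw [hn]⟩
    have := hn i
    rwa [hA, norm_powers, norm_powers, h.zpow_inj] at this
  rw [integrand, hx, weilRep_borelG_mul h hJ hρ hs t' (A n') hk]
  simp only [Set.indicator_apply, hmem]
  by_cases hn : n' ∈ S
  · obtain ⟨hr, hW⟩ := (hS n').mp hn
    rw [Finset.sum_eq_single n' (fun n _ hne => Finset.sum_eq_zero fun t _ =>
      if_neg fun hc => hne hc.1.symm) (fun hc => absurd hn hc)]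
    simp only [true_and]
    by_cases hP : ‖∑ i, t' i‖ ≤ normProd (A n')
    · obtain ⟨t, ⟨ht, htx⟩, htu⟩ := (hT n' hn).existsUnique _ hP
      rw [Finset.sum_eq_single t (fun u hu hne => if_neg fun hc => hne (htu u ⟨hu, hc⟩))
        (fun hc => absurd ht hc), if_pos htx]
      have hmax : max ‖∑ i, t' i‖ (radius (A n')) = max ‖t‖ (radius (A n')) := by
        have h1 : t = ∑ i, t' i - (∑ i, t' i - t) := by ring
        have h2 : ∑ i, t' i = t + (∑ i, t' i - t) := by ring
        refine le_antisymm (max_le ?_ (le_max_right _ _)) (max_le ?_ (le_max_right _ _))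
        · rw [h2]
          exact (IsUltrametricDist.norm_add_le_max _ _).trans (max_le_max le_rfl htx)
        · rw [h1]
          exact (norm_sub_le_max_norm _ _).trans (max_le_max le_rfl htx)
      have hb : basicFun ϖ (gamma0 F * embedG (borelG t' (A n') * k)) =
          basicFun ϖ (gamma0 F * embedG (borelG (Pi.single 0 t) (A n'))) := by
        have h1 := hasSum_basicFun_gamma0 h t' (A n') hk
        have h2 := hasSum_basicFun_gamma0 h (Pi.single 0 t) (A n') (one_mem (integralG F))
        rw [sum_single_zero, mul_one] at h2
        rw [hmax] at h1
        exact h1.unique h2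
      have hψt : ψ ((∑ i, t' i) * s) = ψ (t * s) := by
        have h1 : (∑ i, t' i) * s = t * s + (∑ i, t' i - t) * s := by ring
        rw [h1, AddChar.map_add_eq_mul, hψ.eq_one (x := (∑ i, t' i - t) * s), mul_one]
        rw [norm_mul, mul_comm]
        exact (mul_le_mul_of_nonneg_left htx (norm_nonneg _)).trans
          (norm_mul_radius_le_one hψ hρ hs hW)
      rw [hb, hψt]
    · rw [basicFun_gamma0_eq_zero h hk (lt_max_of_lt_left (not_le.mp hP)), zero_mul,
        Finset.sum_eq_zero]
      refine fun t ht => if_neg fun hc => hP ?_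
      have h2 : ∑ i, t' i = t + (∑ i, t' i - t) := by ring
      rw [h2]
      exact (IsUltrametricDist.norm_add_le_max _ _).trans
        (max_le ((hT n' hn).norm_le t ht) (hc.trans hr))
  · rw [Finset.sum_eq_zero fun n hnS => Finset.sum_eq_zero fun t _ =>
      if_neg (show ¬(n' = n ∧ _) from fun hc => hn (hc.1 ▸ hnS))]
    by_cases hr : radius (A n') ≤ normProd (A n')
    · have hW : weilFactor J v (A n') = 0 := by
        by_contra hW
        exact hn ((hS n').mpr ⟨hr, hW⟩)
      rw [hW, mul_zero, mul_zero]
    · rw [basicFun_gamma0_eq_zero h hk (lt_max_of_lt_right (not_le.mp hr)), zero_mul]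

variable [ProperSpace F] [MeasurableSpace (SpecialLinearGroup (Fin 2) F)]
  [BorelSpace (SpecialLinearGroup (Fin 2) F)]

theorem integrable_and_hasSum_localIntegral {ϖ : F} (h : IsNormalizedUniformizer ϖ)
    (hψ : IsUnramifiedChar ψ) (hJ : ∀ i, ∀ u : F, ‖u‖ = 1 → chi (J i) u = 1)
    (hρ : ∀ k ∈ GO F, weilRep ψ J dt k ((VO F d).indicator 1) = (VO F d).indicator 1)
    {dg : Measure (G F)} (hdg : dg.IsHaarMeasure) (hdg1 : dg (GO F) = 1)
    {dn : Measure (N0 F)} (hdn : dn.IsHaarMeasure) (hdn1 : dn {n | (n : G F) ∈ GO F} = 1)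
    {dx : Measure (N0Quot F)} (hdx : IsQuotientMeasure dg dn dx)
    {v : V F d} {s : F} (hs : ∀ i, quadForm (J i) (v i) = s) {S : Finset (Fin 3 → ℤ)}
    (hS : ∀ n, n ∈ S ↔ radius (powers (Units.mk0 ϖ h.ne_zero) n) ≤
      normProd (powers (Units.mk0 ϖ h.ne_zero) n) ∧
      weilFactor J v (powers (Units.mk0 ϖ h.ne_zero) n) ≠ 0) :
    Integrable (integrand ψ J dt (basicFun ϖ) ((VO F d).indicator 1) v) dx ∧
      HasSum (fun j => ∑ n ∈ S, orbitalTerm ϖ J v s j (powers (Units.mk0 ϖ h.ne_zero) n))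
        (localIntegral ψ J dt dx (basicFun ϖ) ((VO F d).indicator 1) v) := by
  set A := powers (Units.mk0 ϖ h.ne_zero) with hA
  have hrad : ∀ n, 0 < radius (A n) := fun n => by
    obtain ⟨i, hi, -⟩ := exists_radius_eq (A n)
    have := norm_unit_pos (A n i)
    rw [hi]; positivity
  have hTex : ∀ n, ∃ T : Finset F, n ∈ S → IsBallTransversal (normProd (A n)) (radius (A n)) T := by
    intro n
    by_cases hn : n ∈ S
    · obtain ⟨T, hT⟩ := exists_isBallTransversal (F := F) (hrad n) ((hS n).mp hn).1
      exact ⟨T, fun _ => hT⟩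
    · exact ⟨∅, fun hc => absurd hc hn⟩
  choose T hT using hTex
  have hfun := funext (integrand_eq_sum h hψ hJ hρ hs hS (T := T) hT)
  rw [← hA] at hfun
  have hreal : ∀ (n : Fin 3 → ℤ) (t : F), dx.real (quotientCell (borelG (Pi.single 0 t) (A n))) =
      radius (A n) / normProd (A n) ^ 2 := fun n t =>
    measureReal_quotientCell h hdg hdg1 hdn hdn1 hdx _ _
  have hint : ∀ (n : Fin 3 → ℤ) (t : F) (c : ℂ), Integrable
      ((quotientCell (borelG (Pi.single 0 t) (A n))).indicator fun _ => c) dx := by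
    intro n t c
    refine (integrable_indicator_iff (measurableSet_quotientCell _)).mpr
      (integrableOn_const fun htop => ?_)
    have h1 := hreal n t
    rw [Measure.real, htop, ENNReal.toReal_top] at h1
    exact (div_pos (hrad n) (pow_pos (normProd_pos (A n)) 2)).ne h1
  refine ⟨?_, ?_⟩
  · rw [hfun]
    exact integrable_finsetSum _ fun n _ => integrable_finsetSum _ fun t _ => hint n t _
  · have hI : localIntegral ψ J dt dx (basicFun ϖ) ((VO F d).indicator 1) v =
        ∑ n ∈ S, ∑ t ∈ T n, ((radius (A n) / normProd (A n) ^ 2 : ℝ) : ℂ) *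
          (basicFun ϖ (gamma0 F * embedG (borelG (Pi.single 0 t) (A n))) *
          ((ψ (t * s) : ℂ) * weilFactor J v (A n))) := by
      rw [localIntegral, hfun, integral_finsetSum _ fun n _ =>
        integrable_finsetSum _ fun t _ => hint n t _]
      refine Finset.sum_congr rfl fun n _ => ?_
      rw [integral_finsetSum _ fun t _ => hint n t _]
      refine Finset.sum_congr rfl fun t _ => ?_
      rw [integral_indicator_const _ (measurableSet_quotientCell _), hreal, Complex.real_smul]
    rw [hI]
    refine hasSum_sum fun n hn => ?_
    have hsn := norm_mul_radius_le_one hψ hρ hs ((hS n).mp hn).2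
    rw [funext fun j => (sum_transversal_eq_orbitalTerm h hψ j hsn (hT n hn)).symm]
    refine hasSum_sum fun t _ => ?_
    have h1 := hasSum_basicFun_gamma0 h (Pi.single 0 t) (A n) (one_mem (integralG F))
    rw [sum_single_zero, mul_one] at h1
    convert (h1.mul_right ((ψ (t * s) : ℂ) * weilFactor J v (A n))).mul_left
      ((radius (A n) / normProd (A n) ^ 2 : ℝ) : ℂ) using 5

end LocalIntegral

section Formula

variable {F : Type*} [NontriviallyNormedField F]

instance [MeasurableSpace F] [BorelSpace F] [SecondCountableTopology F] : MeasurableMul Fˣ where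
  measurable_const_mul c := by
    refine measurable_comap_iff.mpr ?_
    exact (comap_measurable (Units.val : Fˣ → F)).const_mul (c : F)
  measurable_mul_const c := by
    refine measurable_comap_iff.mpr ?_
    exact (comap_measurable (Units.val : Fˣ → F)).mul_const (c : F)

theorem measurable_norm_apply [MeasurableSpace F] [BorelSpace F] (i : Fin 3) :
    Measurable fun a : Fin 3 → Fˣ => ‖(a i : F)‖ :=
  ((comap_measurable (Units.val : Fˣ → F)).comp (measurable_pi_apply i)).norm

/-- The set of `a` with `|a_i| = |ϖ|^{m_i}`. -/
def shell (ϖ : F) (m : Fin 3 → ℤ) : Set (Fin 3 → Fˣ) := {a | ∀ i, ‖(a i : F)‖ = ‖ϖ‖ ^ m i}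

theorem measurableSet_shell [MeasurableSpace F] [BorelSpace F] (ϖ : F) (m : Fin 3 → ℤ) :
    MeasurableSet (shell ϖ m) := by
  have : shell ϖ m = ⋂ i, {a | ‖(a i : F)‖ = ‖ϖ‖ ^ m i} := by ext; simp [shell]
  rw [this]
  exact MeasurableSet.iInter fun i => measurable_norm_apply i (measurableSet_singleton _)

theorem measure_shell [MeasurableSpace F] [BorelSpace F] [SecondCountableTopology F]
    {da : Measure (Fin 3 → Fˣ)} (hda : da.IsHaarMeasure)
    (hda1 : da {a | ∀ i, ‖(a i : F)‖ = 1} = 1) {ϖ : F} (h : ϖ ≠ 0) (m : Fin 3 → ℤ) :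
    da (shell ϖ m) = 1 := by
  have : shell ϖ m = (fun a => (powers (Units.mk0 ϖ h) m)⁻¹ * a) ⁻¹'
      {a : Fin 3 → Fˣ | ∀ i, ‖(a i : F)‖ = 1} := by
    ext a
    simp only [shell, Set.mem_preimage, Set.mem_ofPred_eq, Pi.mul_apply, Pi.inv_apply,
      Units.val_mul, norm_mul, Units.val_inv_eq_inv_val, norm_inv, norm_powers]
    refine forall_congr' fun i => ?_
    rw [inv_mul_eq_one₀ (zpow_ne_zero _ (norm_ne_zero_iff.mpr h)), eq_comm]
  rw [this, measure_preimage_mul, hda1]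

variable [IsUltrametricDist F]

theorem measurableSet_domainA [MeasurableSpace F] [BorelSpace F] [SecondCountableTopology F] :
    MeasurableSet (domainA F) := by
  have hn := measurable_norm_apply (F := F)
  have h1 : MeasurableSet (⋂ i, {a : Fin 3 → Fˣ | ‖(a i : F)‖ ≤ 1}) :=
    MeasurableSet.iInter fun i => measurableSet_le (hn i) measurable_const
  have h2 : MeasurableSet {a : Fin 3 → Fˣ | max (max (‖(a 0 : F)‖⁻¹ * ‖(a 1 : F)‖ * ‖(a 2 : F)‖)
      (‖(a 1 : F)‖⁻¹ * ‖(a 0 : F)‖ * ‖(a 2 : F)‖))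
      (‖(a 2 : F)‖⁻¹ * ‖(a 0 : F)‖ * ‖(a 1 : F)‖) ≤ 1} :=
    measurableSet_le (((((hn 0).inv.mul (hn 1)).mul (hn 2)).max
      (((hn 1).inv.mul (hn 0)).mul (hn 2))).max (((hn 2).inv.mul (hn 0)).mul (hn 1)))
      measurable_const
  convert h1.inter h2 using 1
  ext a
  simp [domainA, Valued.integer.mem_iff]

variable {d : Fin 3 → ℕ} {J : (i : Fin 3) → Matrix (Fin (d i)) (Fin (d i)) F} {v : V F d}

/-- The substitution `a ↦ (x a)⁻¹`. -/
def invScale (x : Fˣ) (a : Fin 3 → Fˣ) : Fin 3 → Fˣ := fun i => (x * a i)⁻¹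

theorem mem_domainA_iff {ϖ : F} (h : IsNormalizedUniformizer ϖ) (j : ℕ) (a : Fin 3 → Fˣ) :
    a ∈ domainA F ↔ radius (invScale (Units.mk0 ϖ h.ne_zero ^ (2 * j)) a) ≤
      ‖ϖ‖ ^ (2 * j) * normProd (invScale (Units.mk0 ϖ h.ne_zero ^ (2 * j)) a) := by
  have hw : 0 < ‖ϖ‖ ^ (2 * j) := pow_pos h.norm_pos _
  have p0 := norm_unit_pos (a 0)
  have p1 := norm_unit_pos (a 1)
  have p2 := norm_unit_pos (a 2)
  have hnorm : ∀ i, ‖((invScale (Units.mk0 ϖ h.ne_zero ^ (2 * j)) a i : Fˣ) : F)‖ =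
      (‖ϖ‖ ^ (2 * j) * ‖(a i : F)‖)⁻¹ := fun i => by simp [invScale]
  have h3 : ∀ f : Fin 3 → Prop, (∀ l, f l) ↔ f 0 ∧ f 1 ∧ f 2 := fun f =>
    ⟨fun hf => ⟨hf 0, hf 1, hf 2⟩, fun ⟨_, _, _⟩ l => by fin_cases l <;> assumption⟩
  have key : ∀ w x y z : ℝ, 0 < w → 0 < x → 0 < y → 0 < z →
      (((w * x)⁻¹) ^ 2 ≤ w * ((w * x)⁻¹ * (w * y)⁻¹ * (w * z)⁻¹) ↔ x⁻¹ * y * z ≤ 1) := by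
    intro w x y z hw hx hy hz
    have e : w * ((w * x)⁻¹ * (w * y)⁻¹ * (w * z)⁻¹) = ((w * x)⁻¹) ^ 2 * (x⁻¹ * y * z)⁻¹ := by
      field_simp
    rw [e, le_mul_iff_one_le_right (by positivity), one_le_inv₀ (by positivity)]
  have k0 := key _ _ _ _ hw p0 p1 p2
  have k1 := key _ _ _ _ hw p1 p0 p2
  have k2 := key _ _ _ _ hw p2 p0 p1
  have hiff : radius (invScale (Units.mk0 ϖ h.ne_zero ^ (2 * j)) a) ≤
      ‖ϖ‖ ^ (2 * j) * normProd (invScale (Units.mk0 ϖ h.ne_zero ^ (2 * j)) a) ↔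
      max (max ‖(a 0 : F)⁻¹ * a 1 * a 2‖ ‖(a 1 : F)⁻¹ * a 0 * a 2‖)
        ‖(a 2 : F)⁻¹ * a 0 * a 1‖ ≤ 1 := by
    rw [radius_le_iff, h3, normProd, Fin.prod_univ_three]
    simp only [hnorm, max_le_iff, norm_mul, norm_inv]
    rw [← k0, ← k1, ← k2, and_assoc, mul_comm (‖ϖ‖ ^ (2 * j) * ‖(a 1 : F)‖)⁻¹,
      mul_rotate (‖ϖ‖ ^ (2 * j) * ‖(a 2 : F)‖)⁻¹]
  rw [hiff]
  refine ⟨And.right, fun hmax => ⟨fun i => ?_, hmax⟩⟩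
  have le_one : ∀ x y z : ℝ, 0 < x → 0 < y → 0 < z → x⁻¹ * y * z ≤ 1 → y⁻¹ * x * z ≤ 1 →
      z ≤ 1 := by
    intro x y z hx hy hz h1 h2
    have h3 : z ^ 2 = (x⁻¹ * y * z) * (y⁻¹ * x * z) := by field_simp
    have h4 : z ^ 2 ≤ 1 := h3 ▸ mul_le_one₀ h1 (by positivity) h2
    exact (sq_le_one_iff₀ hz.le).mp h4
  simp only [max_le_iff, norm_mul, norm_inv] at hmax
  obtain ⟨⟨m0, m1⟩, m2⟩ := hmax
  rw [Valued.integer.mem_iff]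
  fin_cases i
  · exact le_one _ _ _ p1 p2 p0 (by rwa [mul_right_comm]) (by rwa [mul_right_comm])
  · exact le_one _ _ _ p0 p2 p1 (by rwa [mul_right_comm]) m2
  · exact le_one _ _ _ p0 p1 p2 m0 m1

/-- The integrand of the formula is the orbital term at the substituted torus element. -/
theorem indicator_formulaTerm_eq_orbitalTerm {ϖ : F} (h : IsNormalizedUniformizer ϖ)
    {s s' : F} (hs : ‖s'‖ = ‖s‖) (j : ℕ) (a : Fin 3 → Fˣ) :
    (domainA F).indicator (formulaTerm J ϖ s' v j) a =
      orbitalTerm ϖ J v s j (invScale (Units.mk0 ϖ h.ne_zero ^ (2 * j)) a) := by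
  classical
  set b := invScale (Units.mk0 ϖ h.ne_zero ^ (2 * j)) a with hb
  have hval : ∀ i, (b i : F) = (ϖ ^ (2 * j) * (a i : F))⁻¹ := fun i => by simp [hb, invScale]
  have hnorm : ∀ i, ‖(b i : F)‖ = (‖ϖ‖ ^ (2 * j) * ‖(a i : F)‖)⁻¹ := fun i => by simp [hval]
  have hw : 0 < ‖ϖ‖ := h.norm_pos
  have e1 : s' / (ϖ ^ (4 * j) * ((a 0 : F) * a 1 * a 2)) ∈ (𝒪[F] : Set F) ↔
      ‖s‖ * (‖ϖ‖ ^ (2 * j) * normProd b) ≤ 1 := by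
    have p0 := norm_unit_pos (a 0)
    have p1 := norm_unit_pos (a 1)
    have p2 := norm_unit_pos (a 2)
    have : ‖s' / (ϖ ^ (4 * j) * ((a 0 : F) * a 1 * a 2))‖ =
        ‖s‖ * (‖ϖ‖ ^ (2 * j) * normProd b) := by
      simp only [normProd, Fin.prod_univ_three, hnorm, norm_div, norm_mul, norm_pow, hs]
      rw [show 4 * j = 2 * j + 2 * j by ring, pow_add]
      field_simp
    rw [← this]
    exact Valued.integer.mem_iff
  have e2 : (starRingEnd ℂ) (chiQ J fun i => ϖ ^ (2 * j) * (a i : F)) =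
      ∏ i, (chi (J i) (b i : F) : ℂ) := by
    rw [chiQ, map_prod]
    refine Finset.prod_congr rfl fun i _ => ?_
    rw [map_intCast, hval, chi_inv _ (mul_ne_zero (pow_ne_zero _ h.ne_zero) (a i).ne_zero)]
  have e3 : ∀ i, (‖(a i : F)‖ / (Nat.card 𝓀[F] : ℝ) ^ (2 * j)) ^ (1 - (d i : ℝ) / 2) =
      ‖(b i : F)‖⁻¹ * ‖(b i : F)‖ ^ ((d i : ℝ) / 2) := fun i => by
    have hp := norm_unit_pos (b i)
    have : ‖(a i : F)‖ / (Nat.card 𝓀[F] : ℝ) ^ (2 * j) = ‖(b i : F)‖⁻¹ := by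
      rw [h.card_eq, hnorm, inv_inv, inv_pow, div_inv_eq_mul, mul_comm]
    rw [this, Real.rpow_sub (inv_pos.mpr hp), Real.rpow_one, Real.inv_rpow hp.le, div_inv_eq_mul]
  rw [orbitalTerm, Set.indicator_apply]
  simp only [mem_domainA_iff h j a, ← hb]
  refine if_congr Iff.rfl ?_ rfl
  rw [formulaTerm, Set.indicator_apply, e2, indicator_VO, Finset.prod_congr rfl fun i _ =>
    congrArg Complex.ofReal (e3 i), weilFactor, Finset.prod_mul_distrib, Finset.prod_mul_distrib]
  simp only [e1, hval, Complex.ofReal_mul, Finset.prod_mul_distrib, Pi.one_apply]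
  split_ifs
  · rw [normProd, ← Finset.prod_inv_distrib, Complex.ofReal_prod]
    simp only [hval]
    ring
  · simp only [zero_mul]

theorem mem_shell_invScale_iff {ϖ : F} (h : IsNormalizedUniformizer ϖ) (j : ℕ) (n : Fin 3 → ℤ)
    (a : Fin 3 → Fˣ) : a ∈ shell ϖ (fun i => -(n i + 2 * j)) ↔
      ∀ i, ‖((invScale (Units.mk0 ϖ h.ne_zero ^ (2 * j)) a i : Fˣ) : F)‖ = ‖ϖ‖ ^ n i := by
  refine forall_congr' fun i => ?_
  have hnorm : ‖((invScale (Units.mk0 ϖ h.ne_zero ^ (2 * j)) a i : Fˣ) : F)‖ =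
      (‖ϖ‖ ^ (2 * j) * ‖(a i : F)‖)⁻¹ := by simp [invScale]
  have hw := h.norm_pos.ne'
  have e : ‖ϖ‖ ^ (2 * (j : ℤ)) = ‖ϖ‖ ^ (2 * j) := by exact_mod_cast zpow_natCast ‖ϖ‖ (2 * j)
  rw [hnorm, _root_.zpow_neg, zpow_add₀ hw, e, inv_eq_iff_eq_inv, mul_inv, mul_comm (_ ^ (2 * j)),
    ← eq_div_iff (pow_ne_zero _ hw), div_eq_mul_inv]

theorem indicator_formulaTerm_eq_sum {ϖ : F} (h : IsNormalizedUniformizer ϖ)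
    (hJ : ∀ i, ∀ u : F, ‖u‖ = 1 → chi (J i) u = 1) {s s' : F} (hs : ‖s'‖ = ‖s‖)
    {S : Finset (Fin 3 → ℤ)}
    (hS : ∀ n, n ∈ S ↔ radius (powers (Units.mk0 ϖ h.ne_zero) n) ≤
      normProd (powers (Units.mk0 ϖ h.ne_zero) n) ∧
      weilFactor J v (powers (Units.mk0 ϖ h.ne_zero) n) ≠ 0) (j : ℕ) (a : Fin 3 → Fˣ) :
    (domainA F).indicator (formulaTerm J ϖ s' v j) a =
      ∑ n ∈ S, (shell ϖ fun i => -(n i + 2 * j)).indicator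
        (fun _ => orbitalTerm ϖ J v s j (powers (Units.mk0 ϖ h.ne_zero) n)) a := by
  classical
  rw [indicator_formulaTerm_eq_orbitalTerm h hs]
  set b := invScale (Units.mk0 ϖ h.ne_zero ^ (2 * j)) a with hb
  choose m hm using fun i => h.exists_zpow (b i).ne_zero
  rw [orbitalTerm_congr hJ s j (b := powers (Units.mk0 ϖ h.ne_zero) m)
    fun i => by rw [hm, norm_powers]]
  have hmem : ∀ n : Fin 3 → ℤ, a ∈ shell ϖ (fun i => -(n i + 2 * j)) ↔ m = n := fun n => by
    rw [mem_shell_invScale_iff h, ← hb, funext_iff]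
    exact forall_congr' fun i => by rw [hm, h.zpow_inj]
  simp only [Set.indicator_apply, hmem, Finset.sum_ite_eq]
  split_ifs with hmS
  · rfl
  · refine ite_eq_right_iff.mpr fun hr =>
      mul_eq_zero_of_right _ (by_contra fun hW => hmS ((hS m).mpr ⟨hr.trans ?_, hW⟩))
    exact mul_le_of_le_one_left (normProd_pos _).le (pow_le_one₀ h.norm_pos.le h.norm_lt_one.le)

theorem integrableOn_and_integral_formulaTerm [ProperSpace F] [MeasurableSpace F] [BorelSpace F]
    {da : Measure (Fin 3 → Fˣ)} (hda : da.IsHaarMeasure)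
    (hda1 : da {a | ∀ i, ‖(a i : F)‖ = 1} = 1) {ϖ : F} (h : IsNormalizedUniformizer ϖ)
    (hJ : ∀ i, ∀ u : F, ‖u‖ = 1 → chi (J i) u = 1) {s s' : F} (hs : ‖s'‖ = ‖s‖)
    {S : Finset (Fin 3 → ℤ)}
    (hS : ∀ n, n ∈ S ↔ radius (powers (Units.mk0 ϖ h.ne_zero) n) ≤
      normProd (powers (Units.mk0 ϖ h.ne_zero) n) ∧
      weilFactor J v (powers (Units.mk0 ϖ h.ne_zero) n) ≠ 0) (j : ℕ) :
    IntegrableOn (formulaTerm J ϖ s' v j) (domainA F) da ∧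
      ∫ a in domainA F, formulaTerm J ϖ s' v j a ∂da =
        ∑ n ∈ S, orbitalTerm ϖ J v s j (powers (Units.mk0 ϖ h.ne_zero) n) := by
  have hint : ∀ (m : Fin 3 → ℤ) (c : ℂ), Integrable ((shell ϖ m).indicator fun _ => c) da :=
    fun m c => (integrable_indicator_iff (measurableSet_shell ϖ m)).mpr
      (integrableOn_const (by rw [measure_shell hda hda1 h.ne_zero]; exact ENNReal.one_ne_top))
  have hfun := funext (indicator_formulaTerm_eq_sum (v := v) h hJ hs hS j)
  rw [← integrable_indicator_iff measurableSet_domainA,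
    ← integral_indicator measurableSet_domainA, hfun]
  refine ⟨integrable_finsetSum _ fun n _ => hint _ _, ?_⟩
  rw [integral_finsetSum _ fun n _ => hint _ _]
  refine Finset.sum_congr rfl fun n _ => ?_
  rw [integral_indicator_const _ (measurableSet_shell ϖ _), Measure.real,
    measure_shell hda hda1 h.ne_zero, ENNReal.toReal_one, one_smul]

end Formula

end UnramifiedTriple

open UnramifiedTriple in
theorem proposition6p3
    {p : ℕ} {F : Type*} [NontriviallyNormedField F] [IsUltrametricDist F]
    [IsUnramifiedLocalField p F] [MeasurableSpace F] [BorelSpace F]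
    [MeasurableSpace (SpecialLinearGroup (Fin 2) F)] [BorelSpace (SpecialLinearGroup (Fin 2) F)]
    -- a uniformizer and an unramified additive character
    (ϖ : 𝒪[F]) (hϖ : Irreducible ϖ)
    (ψ : AddChar F Circle) (hψ : IsUnramifiedChar ψ)
    -- three nondegenerate quadratic spaces of positive even dimension
    (d : Fin 3 → ℕ) (hd : ∀ i, Even (d i) ∧ 0 < d i)
    (J : (i : Fin 3) → Matrix (Fin (d i)) (Fin (d i)) F)
    (hJ : ∀ i, (J i).IsSymm ∧ (J i).det ≠ 0)
    -- the character `χ_𝒬` is unramified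
    (hχ : ∀ u : Fin 3 → F, (∀ i, ‖u i‖ = 1) → chiQ J u = 1)
    -- self-dual measures on the quadratic spaces
    (dt : (i : Fin 3) → Measure (Fin (d i) → F)) (hdt : ∀ i, IsSelfDual ψ (J i) (dt i))
    -- the characteristic function of `V(𝒪)` is fixed by `SL₂(𝒪)³`
    (hρ : ∀ k ∈ GO F, weilRep ψ J dt k ((VO F d).indicator 1) = (VO F d).indicator 1)
    -- Haar measures giving `SL₂(𝒪)³`, `N₀(𝒪)` and `(𝒪ˣ)³` measure one; the quotient measure
    (dg : Measure (G F)) (hdg : dg.IsHaarMeasure) (hdg1 : dg (GO F) = 1)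
    (dn : Measure (N0 F)) (hdn : dn.IsHaarMeasure) (hdn1 : dn {n | (n : G F) ∈ GO F} = 1)
    (dx : Measure (N0Quot F)) (hdx : IsQuotientMeasure dg dn dx)
    (da : Measure (Fin 3 → Fˣ)) (hda : da.IsHaarMeasure)
    (hda1 : da {a | ∀ i, ‖(a i : F)‖ = 1} = 1)
    (v : V F d) (hv : v ∈ Ysm J) :
    -- the integral defining `I(b, 𝟙_{V(𝒪)})(v)` converges absolutely
    Integrable (integrand ψ J dt (basicFun (ϖ : F)) ((VO F d).indicator 1) v) dx ∧
    -- the formula, in residue characteristic different from three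
    (p ≠ 3 →
      (∀ j, IntegrableOn (formulaTerm J (ϖ : F) (totalQuad J v) v j) (domainA F) da) ∧
      HasSum (fun j => ∫ a in domainA F, formulaTerm J (ϖ : F) (totalQuad J v) v j a ∂da)
        (localIntegral ψ J dt dx (basicFun (ϖ : F)) ((VO F d).indicator 1) v)) ∧
    -- the formula with `𝒬(v) / 3`, in every residue characteristic
    ((∀ j, IntegrableOn (formulaTerm J (ϖ : F) (totalQuad J v / 3) v j) (domainA F) da) ∧
      HasSum (fun j => ∫ a in domainA F, formulaTerm J (ϖ : F) (totalQuad J v / 3) v j a ∂da)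
        (localIntegral ψ J dt dx (basicFun (ϖ : F)) ((VO F d).indicator 1) v)) ∧
    -- the support
    (localIntegral ψ J dt dx (basicFun (ϖ : F)) ((VO F d).indicator 1) v ≠ 0 → v ∈ VO F d) := by
  have : ProperSpace F := IsUnramifiedLocalField.proper p
  have : CharZero F := IsUnramifiedLocalField.charZero p
  have h := IsUnramifiedLocalField.isNormalizedUniformizer (p := p) hϖ
  have hJ1 : ∀ i, ∀ u : F, ‖u‖ = 1 → chi (J i) u = 1 := fun i u hu =>
    chi_eq_one_of_chiQ hχ i hu
  set s := quadForm (J 0) (v 0) with hs0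
  have hs : ∀ i, quadForm (J i) (v i) = s := fun i => hv.1 i 0
  have htotal : totalQuad J v = 3 * s := by
    rw [totalQuad, Fin.sum_univ_three, hs, hs, hs]; ring
  set S := (finite_setOf_weilFactor_ne_zero h hv).toFinset with hSdef
  have hS : ∀ n, n ∈ S ↔ radius (powers (Units.mk0 (ϖ : F) h.ne_zero) n) ≤
      normProd (powers (Units.mk0 (ϖ : F) h.ne_zero) n) ∧
      weilFactor J v (powers (Units.mk0 (ϖ : F) h.ne_zero) n) ≠ 0 := fun n => by
    rw [hSdef, Set.Finite.mem_toFinset, Set.mem_ofPred_eq]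
  obtain ⟨hint, hsum⟩ := integrable_and_hasSum_localIntegral h hψ hJ1 hρ hdg hdg1 hdn hdn1 hdx hs hS
  have formula : ∀ s' : F, ‖s'‖ = ‖s‖ →
      (∀ j, IntegrableOn (formulaTerm J (ϖ : F) s' v j) (domainA F) da) ∧
      HasSum (fun j => ∫ a in domainA F, formulaTerm J (ϖ : F) s' v j a ∂da)
        (localIntegral ψ J dt dx (basicFun (ϖ : F)) ((VO F d).indicator 1) v) := fun s' hs' => by
    have key := integrableOn_and_integral_formulaTerm (v := v) hda hda1 h hJ1 hs' hS
    refine ⟨fun j => (key j).1, ?_⟩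
    simp only [fun j => (key j).2]
    exact hsum
  refine ⟨hint, fun hp => formula _ ?_, formula _ ?_, fun hne => ?_⟩
  · rw [htotal, norm_mul, IsUnramifiedLocalField.norm_three hp, one_mul]
  · rw [htotal, mul_div_cancel_left₀ _ (by norm_num : (3 : F) ≠ 0)]
  · obtain ⟨n, hn⟩ : S.Nonempty := by
      rw [Finset.nonempty_iff_ne_empty]
      intro hemp
      simp only [hemp, Finset.sum_empty] at hsum
      exact hne (hsum.unique hasSum_zero)
    obtain ⟨hr, hW⟩ := (hS n).mp hn
    intro i k
    have h1 := smul_mem_integralVectors_iff.mp (smul_mem_of_weilFactor_ne_zero hW i) k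
    rw [Valued.integer.mem_iff]
    exact (le_mul_of_one_le_left (norm_nonneg _) (one_le_norm_of_radius_le hr i)).trans h1
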